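/- For $\tau$ in the upper half plane $\mathbb H$ put $q=e^{2\pi i\tau}$ and $(a;q)_n=\prod_{j=0}^{n-1}(1-aq^j)$. Let $$g_2(w;q)=\sum_{n\ge 0}\frac{(-q;q)_n\,q^{n(n+1)/2}}{(w;q)_{n+1}(q/w;q)_{n+1}},\qquad \eta(\tau)=q^{1/24}\prod_{n\ge1}(1-q^n),$$ $$\vartheta(z;\tau)=-\sum_{n\in\mathbb Z}(-1)^n e^{\pi i(2n+1)z}q^{\frac{n(n+1)}2+\frac18}.$$ (Equivalently, $\vartheta(z;\tau)=q^{1/8}x^{-1/2}\prod_{n\ge1}(1-q^n)(1-xq^{n-1})(1-x^{-1}q^n)$ with $x=e^{2\pi i z}$.) (1) Let $\tau\in\mathbb H$, let $\alpha\in\mathbb C$ satisfy $2\alpha\neq 2n\tau+m$ for all $m,n\in\mathbb Z$, and let $w=e^{2\pi i\alpha}$. Then the series $g_2(\pm w;q)$ converge absolutely, $\vartheta(2\alpha;2\tau)\ne0$, and $$w\bigl(g_2(w;q)+g_2(-w;q)\bigr)=\frac{2\eta^4(2\tau)}{\eta^2(\tau)\,\vartheta(2\alpha;2\tau)}.$$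 (2) As a function of $(\alpha,\tau)\in\mathbb C\times\mathbb H$, $\varphi(\alpha,\tau)=w(g_2(w;q)+g_2(-w;q))$ is a meromorphic Jacobi form of weight $1/2$ and index $-1$ on $\Gamma_0(2)$. That is: it is meromorphic in both variables; as identities of meromorphic functions, $$\varphi(\alpha+\lambda\tau+\mu,\tau)=(-1)^\lambda e^{2\pi i(\lambda^2\tau+2\lambda\alpha)}\varphi(\alpha,\tau)\quad(\lambda,\mu\in\mathbb Z),$$ $$\varphi\Bigl(\tfrac{\alpha}{c\tau+d},\tfrac{a\tau+b}{c\tau+d}\Bigr)=v(\gamma)(c\tau+d)^{1/2}e^{-2\pi i c\alpha^2/(c\tau+d)}\varphi(\alpha,\tau)\quad\Bigl(\gamma=\begin{pmatrix}a&b\\c&d\end{pmatrix}\in\Gamma_0(2)\Bigr),$$ where the $v(\gamma)$ are roots of unity of bounded order and the square root is principal; and for all $\gamma=\begin{pmatrix}a&b\\c&d\end{pmatrix}\in SL_2(\mathbb Z)$ and $r,s\in\mathbb R$ there are $C,A\in\mathbb R$ such that the translate $(c\tau+d)^{-1/2}e^{2\pi i c\alpha^2/(c\tau+d)}\varphi\bigl(\frac{\alpha}{c\tau+d},\gamma\tau\bigr)$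 at $\alpha=r\tau+s$ is bounded in absolute value by $e^{C\,\mathrm{Im}\,\tau}$ for all $\tau$ with $\mathrm{Im}\,\tau\ge A$ at which it is holomorphic. (3) Let $r\in\mathbb Q$ and let $M\ge1$ be an integer. There is a congruence subgroup $\Gamma\le\Gamma_0(4)$ of $SL_2(\mathbb Z)$, depending only on $r$ and $M$, such that for every $s\in\frac1M\mathbb Z$ for which $r\in\mathbb Z$ and $2s\in\mathbb Z$ do not both hold, the function $$f(\tau)=q^{-r^2}\,w\bigl(g_2(w;q)+g_2(-w;q)\bigr),\qquad w=e^{2\pi i(r\tau+s)},$$ is a weakly holomorphic modular form of weight $1/2$ on $\Gamma$. That is: it is holomorphic on $\mathbb H$; $f(\gamma\tau)=\frac{\theta(\gamma\tau)}{\theta(\tau)}f(\tau)$ for $\gamma\in\Gamma$, with $\theta(\tau)=\sum_{n\in\mathbb Z}q^{n^2}$; and it is meromorphic at all cusps, in the sense that for every $\gamma\in SL_2(\mathbb Z)$ there are $C,A\in\mathbb R$ with $|(c\tau+d)^{-1/2}f(\gamma\tau)|\le e^{C\,\mathrm{Im}\,\tau}$ whenever $\mathrm{Im}\,\tau\ge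 A$. -/

import Mathlib

open scoped MatrixGroups UpperHalfPlane Manifold Topology

noncomputable section

/-- The finite `q`-Pochhammer symbol `(a; q)_n = ∏_{j < n} (1 - a q ^ j)`. -/
def qPoch (a q : ℂ) (n : ℕ) : ℂ := ∏ j ∈ Finset.range n, (1 - a * q ^ j)

/-- The `n`-th term of the series defining the universal mock theta function `g₂(w; q)`. -/
def g2Term (w q : ℂ) (n : ℕ) : ℂ :=
  qPoch (-q) q n * q ^ (n * (n + 1) / 2) / (qPoch w q (n + 1) * qPoch (q / w) q (n + 1))

/-- The universal mock theta function
`g₂(w; q) = ∑_{n ≥ 0} (-q; q)_n q ^ (n(n+1)/2) / ((w; q)_{n+1} (q/w; q)_{n+1})`. -/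
def g2 (w q : ℂ) : ℂ := ∑' n : ℕ, g2Term w q n

/-- The odd Jacobi theta function, for `0 < im τ` and `q = exp (2 π i τ)`,
`ϑ(z; τ) = -∑_{n ∈ ℤ} (-1) ^ n exp (π i (2 n + 1) z) q ^ (n(n+1)/2 + 1/8)`.
The sign is the one for which, with `x = exp (2 π i z)`,
`ϑ(z; τ) = q ^ (1/8) x ^ (-1/2) ∏_{n ≥ 1} (1 - q ^ n) (1 - x q ^ (n-1)) (1 - x⁻¹ q ^ n)`. -/
def oddTheta (z τ : ℂ) : ℂ :=
  -∑' n : ℤ, (-1 : ℂ) ^ n * Complex.exp (Real.pi * Complex.I * (2 * n + 1) * z) *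
    Complex.exp (2 * Real.pi * Complex.I * τ * (n * (n + 1) / 2 + 1 / 8))

/-- The function `w (g₂(w; q) + g₂(-w; q))` of `(α, τ)`, with `w = exp (2 π i α)` and
`q = exp (2 π i τ)`. -/
def g2Sum (p : ℂ × ℂ) : ℂ :=
  Complex.exp (2 * Real.pi * Complex.I * p.1) *
    (g2 (Complex.exp (2 * Real.pi * Complex.I * p.1)) (Complex.exp (2 * Real.pi * Complex.I * p.2))
      + g2 (-Complex.exp (2 * Real.pi * Complex.I * p.1))
          (Complex.exp (2 * Real.pi * Complex.I * p.2)))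

/-- The automorphy denominator `c τ + d` of `γ = (a b; c d)`. -/
def autDenom (γ : SL(2, ℤ)) (τ : ℍ) : ℂ := ((γ 1 0 : ℤ) : ℂ) * (τ : ℂ) + ((γ 1 1 : ℤ) : ℂ)

/-- `φ` is meromorphic (as a function of two complex variables) near the point `p`: off the zero
set of a holomorphic `g` which does not vanish identically near `p`, it is a quotient `f / g` of
holomorphic functions. The values of `φ` on the zero set of `g` are irrelevant. -/
def MeromorphicNear (φ : ℂ × ℂ → ℂ) (p : ℂ × ℂ) : Prop :=
  ∃ f g : ℂ × ℂ → ℂ, AnalyticAt ℂ f p ∧ AnalyticAt ℂ g p ∧ (∃ᶠ x in 𝓝 p, g x ≠ 0) ∧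
    ∀ᶠ x in 𝓝 p, g x ≠ 0 → φ x = f x / g x

/-- The function `φ` of `(z, τ) ∈ ℂ × ℍ` is a meromorphic Jacobi form of weight `k` and index `m` on
`Γ ≤ SL₂(ℤ)`, with character `χ` of the lattice `ℤ²` and a multiplier system of finite order.
As `φ` is meromorphic, its transformation laws are identities of meromorphic functions: they are
required at all points where both of the values of `φ` that occur are values at points of
holomorphy. Powers of `c τ + d` are principal. -/
structure IsMeromorphicJacobiForm (Γ : Subgroup SL(2, ℤ)) (k m : ℚ) (χ : ℤ → ℤ → ℂ)
    (φ : ℂ × ℂ → ℂ) : Prop where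
  finiteIndex : Γ.FiniteIndex
  meromorphic : ∀ (z : ℂ) (τ : ℍ), MeromorphicNear φ (z, (τ : ℂ))
  elliptic : ∀ (l n : ℤ) (z : ℂ) (τ : ℍ), AnalyticAt ℂ φ (z, (τ : ℂ)) →
    AnalyticAt ℂ φ (z + l * (τ : ℂ) + n, (τ : ℂ)) →
    φ (z + l * (τ : ℂ) + n, (τ : ℂ)) =
      χ l n * Complex.exp (-2 * Real.pi * Complex.I * m * (l ^ 2 * (τ : ℂ) + 2 * l * z)) *
        φ (z, (τ : ℂ))
  modular : ∃ v : SL(2, ℤ) → ℂ, (∃ N : ℕ, 0 < N ∧ ∀ γ ∈ Γ, v γ ^ N = 1) ∧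
    ∀ γ ∈ Γ, ∀ (z : ℂ) (τ : ℍ), AnalyticAt ℂ φ (z, (τ : ℂ)) →
      AnalyticAt ℂ φ (z / autDenom γ τ, ((γ • τ : ℍ) : ℂ)) →
      φ (z / autDenom γ τ, ((γ • τ : ℍ) : ℂ)) =
        v γ * autDenom γ τ ^ (k : ℂ) *
          Complex.exp (2 * Real.pi * Complex.I * m * ((γ 1 0 : ℤ) : ℂ) * z ^ 2 / autDenom γ τ) *
          φ (z, (τ : ℂ))
  /-- Growth at the cusps: all `SL₂(ℤ)`-translates of `φ` grow at most like a power of `q⁻¹` along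
  every curve `z = r τ + s` with `r`, `s` real. -/
  growth : ∀ (γ : SL(2, ℤ)) (r s : ℝ), ∃ C A : ℝ, ∀ τ : ℍ, A ≤ τ.im →
    AnalyticAt ℂ φ ((r * (τ : ℂ) + s) / autDenom γ τ, ((γ • τ : ℍ) : ℂ)) →
    ‖autDenom γ τ ^ (-k : ℂ) *
        Complex.exp (-2 * Real.pi * Complex.I * m * ((γ 1 0 : ℤ) : ℂ) * (r * (τ : ℂ) + s) ^ 2 /
          autDenom γ τ) *
        φ ((r * (τ : ℂ) + s) / autDenom γ τ, ((γ • τ : ℍ) : ℂ))‖ ≤ Real.exp (C * τ.im)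

/-- The theta function `θ(τ) = ∑_{n ∈ ℤ} q ^ (n ^ 2)`, `q = exp (2 π i τ)`, which has no zeros on the
upper half plane and defines the automorphy factor `θ(γ τ) / θ(τ)` of weight `1/2` on `Γ₀(4)`. -/
def thetaHalf (τ : ℍ) : ℂ := jacobiTheta (2 * (τ : ℂ))

/-- `f` is a weakly holomorphic modular form of weight `1/2` on `Γ ≤ Γ₀(4)`: it is holomorphic on the
upper half plane, satisfies `f(γ τ) = (θ(γ τ) / θ(τ)) f(τ)` for `γ ∈ Γ`, and is meromorphic at every
cusp, i.e. its translate by any `γ ∈ SL₂(ℤ)` grows at most like a power of `q⁻¹` at `i∞`. -/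
structure IsWeaklyHolomorphicHalf (Γ : Subgroup SL(2, ℤ)) (f : ℍ → ℂ) : Prop where
  le_Gamma0 : Γ ≤ CongruenceSubgroup.Gamma0 4
  holomorphic : MDifferentiable 𝓘(ℂ) 𝓘(ℂ) f
  transform : ∀ γ ∈ Γ, ∀ τ : ℍ, f (γ • τ) * thetaHalf τ = thetaHalf (γ • τ) * f τ
  cusps : ∀ γ : SL(2, ℤ), ∃ C A : ℝ, ∀ τ : ℍ, A ≤ τ.im →
    ‖autDenom γ τ ^ (-(1 / 2) : ℂ) * f (γ • τ)‖ ≤ Real.exp (C * τ.im)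

end

/-! The product `(w; q)_{n+1} (q/w; q)_{n+1}` consists of factors affine in `w + q/w`, so its
reciprocal has an explicit partial fraction expansion (`sum_pfCoeff_div`). Inserting it in `g2` and
exchanging summations leaves an inner sum that does not depend on the pole `k` and equals `(-q; q)_∞
/ (q; q)_∞` (`tsum_gaussTerm`). Hence `g2` is an Appell-type series (`hasSum_g2Term`). In the
combination `w ↦ w` plus `w ↦ -w`, the denominators merge into those for `(w², q²)`, and the
numerators become those of the limiting partial fraction expansion of a reciprocal theta product
(`tsum_reciprocal_theta`). So the mock part cancels, and the Jacobi triple product identifies the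
result with `etaQuot τ / ϑ(2α; 2τ)` (`g2_even_part`).

Everything else is read off this quotient. Ellipticity is the quasi-periodicity of theta. For
modularity, theta and eta are transformed under `SL₂(ℤ)` with continuous automorphy factors of which
only a power is known: the 8th for theta, the 24th for eta. Comparing with `(cτ + d)^{1/2}` gives a
continuous function whose 24th power is 1 on the connected half plane, hence a constant root of
unity; no multiplier is ever computed. The argument `2τ` is handled by `Doubling`, which factors a
matrix of determinant 2 as a unimodular one times an upper triangular one. Poles lie exactly on the
zeros of theta, because the eta quotient never vanishes, and growth at the cusps follows from a
lower bound for theta off the lattice together with bounds for eta.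

At torsion points an exact multiplier is required. It comes from `etaQuot τ = i θ(τ) ϑ(1/2; 2τ)`
(`etaQuot_eq_thetaHalf_mul`): after division by `θ`, the form is a quotient of two values of the
same odd theta function, so the unknown automorphy factor cancels. On a deep enough principal
congruence subgroup both arguments move by lattice vectors and all remaining exponentials are
trivial (`thetaQuot_smul`). -/

open Filter

/-! ### Pochhammer symbols: convergence, bounds, nonvanishing -/

/-- The infinite `q`-Pochhammer symbol `(a; q)_∞`. -/
noncomputable def qInf (a q : ℂ) : ℂ := ∏' j : ℕ, (1 - a * q ^ j)

/-- The triangular number exponent. -/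
def tri (n : ℕ) : ℕ := n * (n + 1) / 2

lemma tri_zero : tri 0 = 0 := rfl

lemma tri_succ (n : ℕ) : tri (n + 1) = tri n + (n + 1) := by
  unfold tri
  rw [show (n + 1) * (n + 1 + 1) = n * (n + 1) + (n + 1) * 2 by ring,
    Nat.add_mul_div_right _ _ two_pos]

lemma tri_add (k m : ℕ) : tri (k + m) = tri k + tri m + k * m := by
  induction m with
  | zero => simp [tri_zero]
  | succ m ih => rw [← add_assoc, tri_succ, ih, tri_succ]; ring

lemma self_le_tri (n : ℕ) : n ≤ tri n := by
  induction n with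
  | zero => simp
  | succ n ih => rw [tri_succ]; omega

lemma qPoch_zero (a q : ℂ) : qPoch a q 0 = 1 := by simp [qPoch]

lemma qPoch_succ (a q : ℂ) (n : ℕ) : qPoch a q (n + 1) = qPoch a q n * (1 - a * q ^ n) := by
  simp [qPoch, Finset.prod_range_succ]

lemma summable_norm_mul_pow {q : ℂ} (hq : ‖q‖ < 1) (a : ℂ) :
    Summable fun j : ℕ => ‖-(a * q ^ j)‖ := by
  simpa using (summable_geometric_of_lt_one (norm_nonneg q) hq).mul_left ‖a‖

lemma multipliable_one_sub_mul_pow {q : ℂ} (hq : ‖q‖ < 1) (a : ℂ) :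
    Multipliable fun j : ℕ => 1 - a * q ^ j := by
  simpa [sub_eq_add_neg] using multipliable_one_add_of_summable (summable_norm_mul_pow hq a)

lemma tendsto_qPoch {q : ℂ} (hq : ‖q‖ < 1) (a : ℂ) :
    Tendsto (qPoch a q) atTop (𝓝 (qInf a q)) :=
  (multipliable_one_sub_mul_pow hq a).hasProd.tendsto_prod_nat

lemma qInf_ne_zero {q : ℂ} (hq : ‖q‖ < 1) {a : ℂ} (h : ∀ j : ℕ, 1 - a * q ^ j ≠ 0) :
    qInf a q ≠ 0 := by
  have := tprod_one_add_ne_zero_of_summable (f := fun j : ℕ => -(a * q ^ j))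
    (by simpa [sub_eq_add_neg] using h) (summable_norm_mul_pow hq a)
  simpa [qInf, sub_eq_add_neg] using this

lemma qPoch_ne_zero {a q : ℂ} (h : ∀ j : ℕ, 1 - a * q ^ j ≠ 0) (n : ℕ) : qPoch a q n ≠ 0 :=
  Finset.prod_ne_zero_iff.2 fun j _ => h j

lemma exists_norm_bound_of_tendsto {u : ℕ → ℂ} {l : ℂ} (h : Tendsto u atTop (𝓝 l)) :
    ∃ C : ℝ, 0 < C ∧ ∀ n, ‖u n‖ ≤ C := by
  obtain ⟨C, hC⟩ := h.norm.bddAbove_range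
  exact ⟨max C 1, by positivity, fun n => (hC ⟨n, rfl⟩).trans (le_max_left _ _)⟩

lemma exists_norm_qPoch_le {q : ℂ} (hq : ‖q‖ < 1) (a : ℂ) :
    ∃ C : ℝ, 0 < C ∧ ∀ n, ‖qPoch a q n‖ ≤ C :=
  exists_norm_bound_of_tendsto (tendsto_qPoch hq a)

lemma exists_norm_qPoch_inv_le {q : ℂ} (hq : ‖q‖ < 1) {a : ℂ} (h : ∀ j : ℕ, 1 - a * q ^ j ≠ 0) :
    ∃ C : ℝ, 0 < C ∧ ∀ n, ‖(qPoch a q n)⁻¹‖ ≤ C :=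
  exists_norm_bound_of_tendsto ((tendsto_qPoch hq a).inv₀ (qInf_ne_zero hq h))

lemma one_sub_ne_zero_of_norm_lt {z : ℂ} (hz : ‖z‖ < 1) : 1 - z ≠ 0 := by
  intro h
  rw [← sub_eq_zero.1 h] at hz
  simp at hz

lemma one_sub_pow_succ_ne_zero {q : ℂ} (hq : ‖q‖ < 1) (n : ℕ) : 1 - q ^ (n + 1) ≠ 0 :=
  one_sub_ne_zero_of_norm_lt (by
    rw [norm_pow]; exact pow_lt_one₀ (norm_nonneg q) hq n.succ_ne_zero)

lemma one_sub_self_mul_pow_ne_zero {q : ℂ} (hq : ‖q‖ < 1) (n : ℕ) : 1 - q * q ^ n ≠ 0 := by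
  simpa [pow_succ'] using one_sub_pow_succ_ne_zero hq n

lemma qPoch_self_ne_zero {q : ℂ} (hq : ‖q‖ < 1) (n : ℕ) : qPoch q q n ≠ 0 :=
  qPoch_ne_zero (one_sub_self_mul_pow_ne_zero hq) n

lemma qInf_self_ne_zero {q : ℂ} (hq : ‖q‖ < 1) : qInf q q ≠ 0 :=
  qInf_ne_zero hq (one_sub_self_mul_pow_ne_zero hq)

lemma qPoch_self_succ (q : ℂ) (n : ℕ) : qPoch q q (n + 1) = qPoch q q n * (1 - q ^ (n + 1)) := by
  rw [qPoch_succ, pow_succ']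

/-! ### Partial fractions -/

/-- The factor of `(w; q)_{n+1} (q/w; q)_{n+1}` with index `k`. -/
noncomputable def pairFactor (w q : ℂ) (k : ℕ) : ℂ := (1 - w * q ^ k) * (1 - q / w * q ^ k)

/-- The coefficients of the partial fraction expansion of `1 / ((w; q)_{n+1} (q/w; q)_{n+1})`. -/
noncomputable def pfCoeff (q : ℂ) (n k : ℕ) : ℂ :=
  (-1) ^ k * q ^ tri k * (1 - q ^ (2 * k + 1)) / (qPoch q q (n - k) * qPoch q q (n + k + 1))

lemma prod_pairFactor (w q : ℂ) (n : ℕ) :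
    ∏ k ∈ Finset.range n, pairFactor w q k = qPoch w q n * qPoch (q / w) q n := by
  simp [pairFactor, qPoch, Finset.prod_mul_distrib]

/-- A closed form for the partial sums, found so that induction applies; `l` records how far the
summation stops short of the last index. -/
lemma sum_pfCoeff_mul_pow_partial {q : ℂ} (hq : ‖q‖ < 1) (m l : ℕ) :
    ∑ k ∈ Finset.range (m + 1), pfCoeff q (m + 1 + l) k * q ^ (m + 1 + l - k) =
      (-1) ^ m * q ^ tri m * q ^ (m + 1 + l) * (1 - q ^ (m + 1)) /
        ((1 - q ^ (m + 1 + l)) * qPoch q q l * qPoch q q (2 * m + 2 + l)) := by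
  induction m generalizing l with
  | zero =>
    have h1 := qPoch_self_ne_zero hq l
    have h2 := qPoch_self_ne_zero hq (l + 1 + 1)
    have h3 := one_sub_pow_succ_ne_zero hq l
    simp only [pfCoeff, tri_zero, zero_add, Finset.range_one, Finset.sum_singleton, mul_zero,
      Nat.sub_zero, pow_zero, add_zero, pow_one, one_mul]
    rw [show 2 + l = l + 1 + 1 by ring, show 1 + l = l + 1 by ring, qPoch_self_succ q l]
    field_simp
  | succ m ih =>
    -- Passing from `m` to `m + 1` with the top index `m + 1 + 1 + l` fixed means using the
    -- hypothesis at `l + 1`.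
    have e := ih (l + 1)
    rw [show m + 1 + (l + 1) = m + 1 + 1 + l by ring] at e
    rw [Finset.sum_range_succ, e]
    simp only [pfCoeff]
    rw [show m + 1 + 1 + l - (m + 1) = l + 1 by omega,
      show 2 * m + 2 + (l + 1) = 2 * m + 3 + l by ring,
      show m + 1 + 1 + l + (m + 1) + 1 = 2 * m + 3 + l + 1 by ring,
      show 2 * (m + 1) + 2 + l = 2 * m + 3 + l + 1 by ring, qPoch_self_succ q l,
      qPoch_self_succ q (2 * m + 3 + l), tri_succ]
    have h1 := qPoch_self_ne_zero hq l
    have h2 := qPoch_self_ne_zero hq (2 * m + 3 + l)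
    have h3 := one_sub_pow_succ_ne_zero hq l
    have h4 : 1 - q ^ (m + 1 + 1 + l) ≠ 0 := by
      simpa [add_right_comm] using one_sub_pow_succ_ne_zero hq (m + 1 + l)
    have h5 := one_sub_pow_succ_ne_zero hq (2 * m + 3 + l)
    field_simp
    ring

/-- The last term is the negative of the partial sum with `l = 0`. This vanishing removes the
polynomial part in the partial fraction induction. -/
lemma sum_pfCoeff_mul_pow {q : ℂ} (hq : ‖q‖ < 1) (n : ℕ) :
    ∑ k ∈ Finset.range (n + 2), pfCoeff q (n + 1) k * q ^ (n + 1 - k) = 0 := by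
  have e := sum_pfCoeff_mul_pow_partial hq n 0
  rw [Finset.sum_range_succ]
  simp only [add_zero] at e
  rw [e, pfCoeff]
  simp only [Nat.sub_self, qPoch_zero, pow_zero]
  rw [show n + 1 + (n + 1) + 1 = 2 * n + 2 + 1 by ring, qPoch_self_succ q (2 * n + 2), tri_succ]
  have h2 := qPoch_self_ne_zero hq (2 * n + 2)
  have h4 := one_sub_pow_succ_ne_zero hq n
  have h5 := one_sub_pow_succ_ne_zero hq (2 * n + 2)
  rw [show 2 * (n + 1) + 1 = 2 * n + 2 + 1 by ring]
  field_simp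
  ring

/-- A new factor in the denominator divides the coefficient at the pole `w = q^{-k}` by the value of
that factor there. -/
lemma pfCoeff_succ {q : ℂ} (hq : ‖q‖ < 1) {n k : ℕ} (hk : k ≤ n) :
    pfCoeff q (n + 1) k * ((1 - q ^ (n + 1 - k)) * (1 - q ^ (n + 1 + k + 1))) = pfCoeff q n k := by
  obtain ⟨l, rfl⟩ := Nat.exists_eq_add_of_le hk
  simp only [pfCoeff]
  rw [show k + l + 1 - k = l + 1 by omega, show k + l - k = l by omega,
    show k + l + 1 + k + 1 = k + l + k + 1 + 1 by ring, qPoch_self_succ q l,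
    qPoch_self_succ q (k + l + k + 1)]
  have h1 := qPoch_self_ne_zero hq l
  have h2 := qPoch_self_ne_zero hq (k + l + k + 1)
  have h3 := one_sub_pow_succ_ne_zero hq l
  have h4 := one_sub_pow_succ_ne_zero hq (k + l + k + 1)
  field_simp

/-- Both factors are affine in `w + q/w`, since `pairFactor w q k = 1 + q^{2k+1} - q^k (w + q/w)`;
eliminating that quantity leaves a constant, the value of factor `n` at the pole of factor `k`. -/
lemma pairFactor_sub {w q : ℂ} (hw : w ≠ 0) {n k : ℕ} (hk : k ≤ n) :
    pairFactor w q n = q ^ (n - k) * pairFactor w q k +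
      (1 - q ^ (n - k)) * (1 - q ^ (n + k + 1)) := by
  obtain ⟨l, rfl⟩ := Nat.exists_eq_add_of_le hk
  rw [show k + l - k = l by omega]
  simp only [pairFactor]
  field_simp
  ring

/-- Partial fraction expansion of `1 / ((w; q)_{n+1} (q/w; q)_{n+1})`. -/
theorem sum_pfCoeff_div {w q : ℂ} (hq : ‖q‖ < 1) (hw : w ≠ 0) (h : ∀ k, pairFactor w q k ≠ 0)
    (n : ℕ) : ∑ k ∈ Finset.range (n + 1), pfCoeff q n k / pairFactor w q k =
      1 / (qPoch w q (n + 1) * qPoch (q / w) q (n + 1)) := by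
  rw [← prod_pairFactor]
  induction n with
  | zero =>
    have h1 := one_sub_pow_succ_ne_zero hq 0
    simp only [zero_add, pow_one] at h1
    simp [pfCoeff, tri_zero, qPoch_self_succ, qPoch_zero, h1]
  | succ n ih =>
    rw [Finset.prod_range_succ, one_div, mul_inv, ← div_eq_mul_inv, eq_div_iff (h _), ← one_div,
      ← ih, Finset.sum_mul]
    have key : ∀ k ∈ Finset.range (n + 2), pfCoeff q (n + 1) k / pairFactor w q k *
        pairFactor w q (n + 1) = pfCoeff q (n + 1) k * q ^ (n + 1 - k) +
        pfCoeff q (n + 1) k * ((1 - q ^ (n + 1 - k)) * (1 - q ^ (n + 1 + k + 1))) /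
          pairFactor w q k := by
      intro k hk
      rw [pairFactor_sub hw (Nat.lt_succ_iff.1 (Finset.mem_range.1 hk))]
      have := h k
      field_simp
    rw [Finset.sum_congr rfl key, Finset.sum_add_distrib, sum_pfCoeff_mul_pow hq, zero_add,
      Finset.sum_range_succ]
    simp only [Nat.sub_self, pow_zero, sub_self, zero_mul, mul_zero, zero_div, add_zero]
    refine Finset.sum_congr rfl fun k hk => ?_
    rw [pfCoeff_succ hq (Nat.lt_succ_iff.1 (Finset.mem_range.1 hk))]

/-! ### A `q`-Gauss sum -/

/-- The terms of the inner sum in the partial fraction expansion of `g2`. -/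
noncomputable def gaussTerm (q : ℂ) (k m : ℕ) : ℂ :=
  qPoch (-q) q (k + m) * q ^ (tri m + k * m) / (qPoch q q m * qPoch q q (2 * k + m + 1))

/-- Comparing `L` terms for `k + 1` with `L + 1` terms for `k` leaves a single product, which tends
to zero; hence the full sum is independent of `k`. -/
lemma gaussTerm_telescope {q : ℂ} (hq : ‖q‖ < 1) (k L : ℕ) :
    ∑ m ∈ Finset.range L, gaussTerm q (k + 1) m - ∑ m ∈ Finset.range (L + 1), gaussTerm q k m =
      -(1 - q ^ (k + 1)) * qPoch (-q) q (k + 1 + L) * q ^ (tri L + (k + 1) * L) /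
        (qPoch q q L * qPoch q q (2 * k + 2 + L)) := by
  induction L with
  | zero =>
    have h1 := qPoch_self_ne_zero hq (2 * k + 1)
    have h2 := one_sub_pow_succ_ne_zero hq (2 * k + 1)
    simp only [Finset.range_zero, Finset.sum_empty, zero_add, Finset.range_one,
      Finset.sum_singleton, gaussTerm, add_zero, tri_zero, mul_zero, pow_zero, qPoch_zero]
    rw [qPoch_succ (-q) q k, show 2 * k + 2 = 2 * k + 1 + 1 by ring, qPoch_self_succ q (2 * k + 1)]
    field_simp
    ring
  | succ L ih =>
    rw [Finset.sum_range_succ, Finset.sum_range_succ _ (L + 1), add_sub_add_comm, ih]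
    simp only [gaussTerm]
    rw [show k + 1 + (L + 1) = k + 1 + L + 1 by ring, show k + (L + 1) = k + 1 + L by ring,
      show 2 * (k + 1) + L + 1 = 2 * k + 2 + L + 1 by ring,
      show 2 * k + (L + 1) + 1 = 2 * k + 2 + L by ring,
      show 2 * k + 2 + (L + 1) = 2 * k + 2 + L + 1 by ring, tri_succ, qPoch_self_succ q L,
      qPoch_self_succ q (2 * k + 2 + L), qPoch_succ (-q) q (k + 1 + L)]
    have h1 := qPoch_self_ne_zero hq L
    have h2 := qPoch_self_ne_zero hq (2 * k + 2 + L)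
    have h3 := one_sub_pow_succ_ne_zero hq L
    have h4 := one_sub_pow_succ_ne_zero hq (2 * k + 2 + L)
    field_simp
    ring

/-- Uniformity in `k` is the point: it serves both the limit `k → ∞` and the summability of the
double series. -/
lemma exists_norm_gaussTerm_le {q : ℂ} (hq : ‖q‖ < 1) :
    ∃ C : ℝ, 0 < C ∧ ∀ k m, ‖gaussTerm q k m‖ ≤ C * ‖q‖ ^ m := by
  obtain ⟨A, hA, h1⟩ := exists_norm_qPoch_le hq (-q)
  obtain ⟨B, hB, h2⟩ := exists_norm_qPoch_inv_le hq (one_sub_self_mul_pow_ne_zero hq)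
  refine ⟨A * B * B, by positivity, fun k m => ?_⟩
  rw [gaussTerm, div_eq_mul_inv, mul_inv, norm_mul, norm_mul, norm_mul, norm_pow]
  have h3 : ‖q‖ ^ (tri m + k * m) ≤ ‖q‖ ^ m :=
    pow_le_pow_of_le_one (norm_nonneg q) hq.le ((self_le_tri m).trans (Nat.le_add_right _ _))
  calc _ ≤ A * ‖q‖ ^ m * (B * B) := by
        gcongr
        · exact h1 _
        · exact h2 _
        · exact h2 _
    _ = _ := by ring

lemma summable_gaussTerm {q : ℂ} (hq : ‖q‖ < 1) (k : ℕ) : Summable (gaussTerm q k) := by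
  obtain ⟨C, -, hC⟩ := exists_norm_gaussTerm_le hq
  exact .of_norm_bounded ((summable_geometric_of_lt_one (norm_nonneg q) hq).mul_left C) (hC k)

lemma tendsto_pow_zero {q : ℂ} (hq : ‖q‖ < 1) : Tendsto (fun n : ℕ => q ^ n) atTop (𝓝 0) :=
  tendsto_pow_atTop_nhds_zero_of_norm_lt_one hq

lemma tsum_gaussTerm_succ {q : ℂ} (hq : ‖q‖ < 1) (k : ℕ) :
    ∑' m, gaussTerm q (k + 1) m = ∑' m, gaussTerm q k m := by
  have h1 := (summable_gaussTerm hq (k + 1)).hasSum.tendsto_sum_nat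
  have h2 := ((summable_gaussTerm hq k).hasSum.tendsto_sum_nat).comp (tendsto_add_atTop_nat 1)
  have h3 := h1.sub h2
  simp only [Function.comp_def, gaussTerm_telescope hq k] at h3
  obtain ⟨A, hA, hA1⟩ := exists_norm_qPoch_le hq (-q)
  obtain ⟨B, hB, hB1⟩ := exists_norm_qPoch_inv_le hq (one_sub_self_mul_pow_ne_zero hq)
  have h4 : Tendsto (fun L : ℕ => -(1 - q ^ (k + 1)) * qPoch (-q) q (k + 1 + L) *
      q ^ (tri L + (k + 1) * L) / (qPoch q q L * qPoch q q (2 * k + 2 + L))) atTop (𝓝 0) := by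
    refine squeeze_zero_norm (a := fun L => ‖1 - q ^ (k + 1)‖ * A * B * B * ‖q‖ ^ L) (fun L => ?_) ?_
    · rw [div_eq_mul_inv, mul_inv, norm_mul, norm_mul, norm_mul, norm_mul, norm_pow, norm_neg]
      have h3 : ‖q‖ ^ (tri L + (k + 1) * L) ≤ ‖q‖ ^ L :=
        pow_le_pow_of_le_one (norm_nonneg q) hq.le ((self_le_tri L).trans (Nat.le_add_right _ _))
      calc _ ≤ ‖1 - q ^ (k + 1)‖ * A * ‖q‖ ^ L * (B * B) := by
            gcongr
            · exact hA1 _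
            · exact hB1 _
            · exact hB1 _
        _ = _ := by ring
    · simpa using (tendsto_pow_atTop_nhds_zero_of_lt_one (norm_nonneg q) hq).const_mul
        (‖1 - q ^ (k + 1)‖ * A * B * B)
  exact sub_eq_zero.1 (tendsto_nhds_unique h3 h4)

/-- The sum does not depend on `k`, so it equals its limit as `k → ∞`, where the factor `q^{km}`
kills every term except `m = 0`. -/
theorem tsum_gaussTerm {q : ℂ} (hq : ‖q‖ < 1) (k : ℕ) :
    ∑' m, gaussTerm q k m = qInf (-q) q / qInf q q := by
  obtain ⟨C, -, hC⟩ := exists_norm_gaussTerm_le hq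
  have hlim : Tendsto (fun k => ∑' m, gaussTerm q k m) atTop
      (𝓝 (∑' m : ℕ, if m = 0 then qInf (-q) q / qInf q q else 0)) := by
    refine tendsto_tsum_of_dominated_convergence
      ((summable_geometric_of_lt_one (norm_nonneg q) hq).mul_left C) (fun m => ?_)
      (.of_forall fun k m => hC k m)
    have t1 : Tendsto (fun k : ℕ => qPoch (-q) q (k + m)) atTop (𝓝 (qInf (-q) q)) :=
      (tendsto_qPoch hq (-q)).comp (tendsto_add_atTop_nat m)
    have t2 : Tendsto (fun k : ℕ => qPoch q q (2 * k + m + 1)) atTop (𝓝 (qInf q q)) :=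
      (tendsto_qPoch hq q).comp
        (tendsto_atTop_mono (fun k => by omega : ∀ k : ℕ, k ≤ 2 * k + m + 1) tendsto_id)
    have t3 : Tendsto (fun k : ℕ => q ^ (tri m + k * m)) atTop (𝓝 (if m = 0 then 1 else 0)) := by
      split_ifs with hm
      · simp [hm, tri_zero]
      · exact (tendsto_pow_zero hq).comp (tendsto_atTop_mono (fun k => by
          have := Nat.le_mul_of_pos_right k (Nat.pos_of_ne_zero hm)
          omega : ∀ k : ℕ, k ≤ tri m + k * m) tendsto_id)
    have t4 : Tendsto (fun k => gaussTerm q k m) atTop _ :=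
      (t1.mul t3).div ((tendsto_const_nhds (x := qPoch q q m)).mul t2)
        (mul_ne_zero (qPoch_self_ne_zero hq m) (qInf_self_ne_zero hq))
    convert t4 using 2
    split_ifs with hm
    · simp [hm, qPoch_zero]
    · simp
  have hconst : ∀ k, ∑' m, gaussTerm q k m = ∑' m, gaussTerm q 0 m := by
    intro k
    induction k with
    | zero => rfl
    | succ k ih => rw [tsum_gaussTerm_succ hq, ih]
  rw [tsum_ite_eq] at hlim
  simp only [hconst] at hlim
  rw [hconst, tendsto_nhds_unique tendsto_const_nhds hlim]

/-! ### The Appell series of `g2` -/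

/-- The factors tend to 1, so their inverses converge and are bounded. A vanishing factor does no
harm, since its inverse is 0 by convention. -/
lemma exists_norm_pairFactor_inv_le {q : ℂ} (hq : ‖q‖ < 1) (w : ℂ) :
    ∃ C : ℝ, 0 < C ∧ ∀ k, ‖(pairFactor w q k)⁻¹‖ ≤ C := by
  refine exists_norm_bound_of_tendsto (l := ((1 - w * 0) * (1 - q / w * 0))⁻¹) (.inv₀ ?_ (by simp))
  exact (tendsto_const_nhds.sub ((tendsto_pow_zero hq).const_mul _)).mul
    (tendsto_const_nhds.sub ((tendsto_pow_zero hq).const_mul _))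

/-- The terms of the double series obtained by expanding `g2` in partial fractions. -/
noncomputable def g2Double (w q : ℂ) (p : ℕ × ℕ) : ℂ :=
  (-1) ^ p.1 * q ^ (2 * tri p.1) * (1 - q ^ (2 * p.1 + 1)) / pairFactor w q p.1 *
    gaussTerm q p.1 p.2

lemma summable_g2Double (w : ℂ) {q : ℂ} (hq : ‖q‖ < 1) :
    Summable (g2Double w q) := by
  obtain ⟨C, hC0, hC⟩ := exists_norm_gaussTerm_le hq
  obtain ⟨E, hE0, hE⟩ := exists_norm_pairFactor_inv_le hq w
  have hg := summable_geometric_of_lt_one (norm_nonneg q) hq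
  have hs := (hg.mul_of_nonneg hg (fun _ => by positivity) fun _ => by positivity).mul_left (2 * E * C)
  refine .of_norm_bounded hs fun p => ?_
  rw [g2Double, div_eq_mul_inv, norm_mul, norm_mul, norm_mul, norm_mul, norm_pow, norm_pow, norm_neg,
    norm_one, one_pow, one_mul]
  have h1 : ‖q‖ ^ (2 * tri p.1) ≤ ‖q‖ ^ p.1 :=
    pow_le_pow_of_le_one (norm_nonneg q) hq.le (by have := self_le_tri p.1; omega)
  have h2 : ‖1 - q ^ (2 * p.1 + 1)‖ ≤ 2 := by
    refine (norm_sub_le _ _).trans ?_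
    rw [norm_one, norm_pow]
    linarith [pow_le_one₀ (n := 2 * p.1 + 1) (norm_nonneg q) hq.le]
  calc _ ≤ ‖q‖ ^ p.1 * 2 * E * (C * ‖q‖ ^ p.2) := by
        gcongr
        · exact hE _
        · exact hC _ _
    _ = _ := by ring

/-- With `n = k + l`, the exponent `tri (k + l)` contributes `tri k + tri l + k l`, and the `tri k`
of `pfCoeff` makes this `2 tri k`; this doubling is what later produces the base `q²`. -/
lemma sum_antidiagonal_g2Double {w q : ℂ} (hq : ‖q‖ < 1) (hw : w ≠ 0)
    (h : ∀ k, pairFactor w q k ≠ 0) (n : ℕ) :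
    ∑ p ∈ Finset.HasAntidiagonal.antidiagonal n, g2Double w q p = g2Term w q n := by
  rw [g2Term, div_eq_mul_one_div, ← sum_pfCoeff_div hq hw h,
    Finset.Nat.sum_antidiagonal_eq_sum_range_succ_mk, Finset.mul_sum]
  refine Finset.sum_congr rfl fun k hk => ?_
  obtain ⟨l, rfl⟩ := Nat.exists_eq_add_of_le (Nat.lt_succ_iff.1 (Finset.mem_range.1 hk))
  simp only [g2Double, gaussTerm, pfCoeff]
  rw [show k + l - k = l by omega, show k + l + k + 1 = 2 * k + l + 1 by ring,
    show (k + l) * (k + l + 1) / 2 = tri (k + l) from rfl, tri_add]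
  have h1 := qPoch_self_ne_zero hq l
  have h2 := qPoch_self_ne_zero hq (2 * k + l + 1)
  have h3 := h k
  field_simp
  ring

/-- The Appell series `∑ (-1)^k q^{2 T(k)} (1 - q^{2k+1}) / ((1 - w q^k)(1 - q^{k+1}/w))`. -/
theorem hasSum_g2Term {w q : ℂ} (hq : ‖q‖ < 1) (hw : w ≠ 0) (h : ∀ k, pairFactor w q k ≠ 0) :
    HasSum (g2Term w q) (∑' k : ℕ, (-1) ^ k * q ^ (2 * tri k) * (1 - q ^ (2 * k + 1)) /
      pairFactor w q k * (qInf (-q) q / qInf q q)) := by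
  have hs := summable_g2Double w hq
  have hv : ∑' p, g2Double w q p = ∑' k : ℕ, (-1) ^ k * q ^ (2 * tri k) *
      (1 - q ^ (2 * k + 1)) / pairFactor w q k * (qInf (-q) q / qInf q q) := by
    rw [hs.tsum_prod]
    refine tsum_congr fun k => ?_
    simp only [g2Double]
    rw [tsum_mul_left, tsum_gaussTerm hq]
  rw [← hv]
  -- The absolutely convergent double series, regrouped along antidiagonals, is the series of `g2`;
  -- summed by rows it is the Appell series.
  have hd := ((Finset.HasAntidiagonal.sigmaAntidiagonalEquivProd (A := ℕ)).hasSum_iff.2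
    hs.hasSum).sigma (fun n => (hasSum_fintype _))
  refine hd.congr_fun fun n => ?_
  rw [← sum_antidiagonal_g2Double hq hw h]
  exact (Finset.sum_coe_sort _ _).symm

lemma summable_appell (w : ℂ) {q : ℂ} (hq : ‖q‖ < 1) :
    Summable fun k : ℕ => (-1) ^ k * q ^ (2 * tri k) * (1 - q ^ (2 * k + 1)) /
      pairFactor w q k * (qInf (-q) q / qInf q q) := by
  have := (summable_g2Double w hq).prod
  simpa only [g2Double, tsum_mul_left, tsum_gaussTerm hq] using this

/-- Partial fraction expansion of the reciprocal of the theta product. -/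
theorem tsum_reciprocal_theta {z q : ℂ} (hq : ‖q‖ < 1) (hz : z ≠ 0)
    (h : ∀ k, pairFactor z q k ≠ 0) :
    ∑' k : ℕ, (-1) ^ k * q ^ tri k * (1 - q ^ (2 * k + 1)) / pairFactor z q k =
      qInf q q ^ 2 / (qInf z q * qInf (q / z) q) := by
  obtain ⟨B, hB, hB1⟩ := exists_norm_qPoch_inv_le hq (one_sub_self_mul_pow_ne_zero hq)
  obtain ⟨E, hE0, hE⟩ := exists_norm_pairFactor_inv_le hq z
  have hz1 : ∀ k, 1 - z * q ^ k ≠ 0 := fun k => left_ne_zero_of_mul (h k)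
  have hz2 : ∀ k, 1 - q / z * q ^ k ≠ 0 := fun k => right_ne_zero_of_mul (h k)
  -- Let `n → ∞` in the finite partial fraction expansion, extended by zero to all `k` so that
  -- dominated convergence applies.
  have hlim : Tendsto (fun n => ∑' k : ℕ, if k ∈ Finset.range (n + 1) then
      pfCoeff q n k / pairFactor z q k else 0) atTop
      (𝓝 (∑' k : ℕ, (-1) ^ k * q ^ tri k * (1 - q ^ (2 * k + 1)) /
        (qInf q q * qInf q q) / pairFactor z q k)) := by
    refine tendsto_tsum_of_dominated_convergence
      ((summable_geometric_of_lt_one (norm_nonneg q) hq).mul_left (2 * B * B * E)) (fun k => ?_)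
      (.of_forall fun n k => ?_)
    · have t1 : Tendsto (fun n : ℕ => qPoch q q (n - k)) atTop (𝓝 (qInf q q)) :=
        (tendsto_qPoch hq q).comp (tendsto_sub_atTop_nat k)
      have t2 : Tendsto (fun n : ℕ => qPoch q q (n + k + 1)) atTop (𝓝 (qInf q q)) :=
        (tendsto_qPoch hq q).comp
          (tendsto_atTop_mono (fun n => by omega : ∀ n : ℕ, n ≤ n + k + 1) tendsto_id)
      have t3 := ((tendsto_const_nhds (x := (-1) ^ k * q ^ tri k * (1 - q ^ (2 * k + 1)))).div
        (t1.mul t2) (mul_ne_zero (qInf_self_ne_zero hq) (qInf_self_ne_zero hq))).div_const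
        (pairFactor z q k)
      refine t3.congr' ?_
      filter_upwards [eventually_ge_atTop k] with n hn
      rw [if_pos (Finset.mem_range.2 (Nat.lt_succ_of_le hn))]
      rfl
    · have h1 : ‖q‖ ^ tri k ≤ ‖q‖ ^ k :=
        pow_le_pow_of_le_one (norm_nonneg q) hq.le (self_le_tri k)
      have h2 : ‖1 - q ^ (2 * k + 1)‖ ≤ 2 := by
        refine (norm_sub_le _ _).trans ?_
        rw [norm_one, norm_pow]
        linarith [pow_le_one₀ (n := 2 * k + 1) (norm_nonneg q) hq.le]
      split_ifs
      · rw [pfCoeff, div_eq_mul_inv, div_eq_mul_inv, mul_inv, norm_mul, norm_mul, norm_mul,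
          norm_mul, norm_mul, norm_pow, norm_pow, norm_neg, norm_one, one_pow, one_mul]
        calc _ ≤ ‖q‖ ^ k * 2 * (B * B) * E := by
              gcongr
              · exact hB1 _
              · exact hB1 _
              · exact hE _
          _ = _ := by ring
      · rw [norm_zero]; positivity
  have hR : ∀ n : ℕ, (∑' k : ℕ, if k ∈ Finset.range (n + 1) then
      pfCoeff q n k / pairFactor z q k else 0) =
      1 / (qPoch z q (n + 1) * qPoch (q / z) q (n + 1)) := fun n => by
    rw [← sum_pfCoeff_div hq hz h, tsum_eq_sum (s := Finset.range (n + 1))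
      (fun k hk => if_neg hk)]
    exact Finset.sum_congr rfl fun k hk => if_pos hk
  simp only [hR] at hlim
  have hlim2 : Tendsto (fun n : ℕ => 1 / (qPoch z q (n + 1) * qPoch (q / z) q (n + 1))) atTop
      (𝓝 (1 / (qInf z q * qInf (q / z) q))) :=
    tendsto_const_nhds.div (((tendsto_qPoch hq z).comp (tendsto_add_atTop_nat 1)).mul
      ((tendsto_qPoch hq (q / z)).comp (tendsto_add_atTop_nat 1)))
      (mul_ne_zero (qInf_ne_zero hq hz1) (qInf_ne_zero hq hz2))
  have e := tendsto_nhds_unique hlim hlim2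
  have hq0 := qInf_self_ne_zero hq
  rw [div_eq_mul_one_div (qInf q q ^ 2), ← e, ← tsum_mul_left]
  refine tsum_congr fun k => ?_
  have := h k
  field_simp

/-- Difference of squares in each factor: this is why the even part lives on `(w², q²)`. -/
lemma pairFactor_mul_neg (w q : ℂ) (k : ℕ) :
    pairFactor w q k * pairFactor (-w) q k = pairFactor (w ^ 2) (q ^ 2) k := by
  simp only [pairFactor, div_neg, ← div_pow]
  ring

/-- The even part of `g2` is a reciprocal theta product. -/
theorem g2_add_g2_neg {w q : ℂ} (hq : ‖q‖ < 1) (hw : w ≠ 0)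
    (h : ∀ k, pairFactor (w ^ 2) (q ^ 2) k ≠ 0) :
    Summable (g2Term w q) ∧ Summable (g2Term (-w) q) ∧
      g2 w q + g2 (-w) q = 2 * (qInf (-q) q / qInf q q) * (qInf (q ^ 2) (q ^ 2) ^ 2 /
        (qInf (w ^ 2) (q ^ 2) * qInf (q ^ 2 / w ^ 2) (q ^ 2))) := by
  have hh := fun k => pairFactor_mul_neg w q k ▸ h k
  have h1 : ∀ k, pairFactor w q k ≠ 0 := fun k => left_ne_zero_of_mul (hh k)
  have h2 : ∀ k, pairFactor (-w) q k ≠ 0 := fun k => right_ne_zero_of_mul (hh k)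
  have s1 := hasSum_g2Term hq hw h1
  have s2 := hasSum_g2Term hq (neg_ne_zero.2 hw) h2
  have hq2 : ‖q ^ 2‖ < 1 := by
    rw [norm_pow]; exact pow_lt_one₀ (norm_nonneg q) hq two_ne_zero
  refine ⟨s1.summable, s2.summable, ?_⟩
  rw [g2, g2, s1.tsum_eq, s2.tsum_eq, ← (summable_appell w hq).tsum_add (summable_appell (-w) hq),
    ← tsum_reciprocal_theta hq2 (pow_ne_zero 2 hw) h, ← tsum_mul_left]
  refine tsum_congr fun k => ?_
  rw [← pairFactor_mul_neg]
  -- Over the common denominator, this sum turns `1 - q^{2k+1}` into `1 - (q²)^{2k+1}`, the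
  -- numerator of the reciprocal theta series with base `q²`.
  have e : pairFactor w q k + pairFactor (-w) q k = 2 * (1 + q ^ (2 * k + 1)) := by
    simp only [pairFactor]
    field_simp
    ring
  have h3 := h1 k
  have h4 := h2 k
  have h5 := qInf_self_ne_zero hq
  have e2 : (-1) ^ k * q ^ (2 * tri k) * (1 - q ^ (2 * k + 1)) / pairFactor w q k *
      (qInf (-q) q / qInf q q) + (-1) ^ k * q ^ (2 * tri k) * (1 - q ^ (2 * k + 1)) /
      pairFactor (-w) q k * (qInf (-q) q / qInf q q) =
      (-1) ^ k * q ^ (2 * tri k) * (1 - q ^ (2 * k + 1)) * (qInf (-q) q / qInf q q) *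
      (pairFactor w q k + pairFactor (-w) q k) / (pairFactor w q k * pairFactor (-w) q k) := by
    field_simp
    ring
  rw [e2, e]
  field_simp
  ring

/-! ### The Jacobi triple product -/

/-- `1 / (q; q)_k`, extended by zero to negative `k`. -/
noncomputable def qPochInv (q : ℂ) (k : ℤ) : ℂ := if k < 0 then 0 else (qPoch q q k.toNat)⁻¹

lemma qPochInv_of_neg (q : ℂ) {k : ℤ} (hk : k < 0) : qPochInv q k = 0 := if_pos hk

lemma qPochInv_natCast (q : ℂ) (k : ℕ) : qPochInv q k = (qPoch q q k)⁻¹ := by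
  simp [qPochInv]

/-- The extension by zero is consistent with the recurrence because `1 - q^0 = 0`, so the boundary
terms of the finite triple product need no separate treatment. -/
lemma qPochInv_sub_one {q : ℂ} (hq : ‖q‖ < 1) (k : ℤ) :
    qPochInv q (k - 1) = (1 - q ^ k) * qPochInv q k := by
  rcases lt_trichotomy k 0 with hk | rfl | hk
  · rw [qPochInv_of_neg q hk, qPochInv_of_neg q (by omega), mul_zero]
  · rw [qPochInv_of_neg q (by omega)]; simp
  · obtain ⟨n, rfl⟩ : ∃ n : ℕ, k = ((n + 1 : ℕ) : ℤ) := ⟨k.toNat - 1, by omega⟩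
    rw [qPochInv_natCast, show ((n + 1 : ℕ) : ℤ) - 1 = (n : ℤ) by push_cast; ring, qPochInv_natCast,
      zpow_natCast, qPoch_self_succ]
    have h1 := qPoch_self_ne_zero hq n
    have h2 := one_sub_pow_succ_ne_zero hq n
    field_simp

/-- The triangular number exponent `m (m - 1) / 2` for integers `m`. -/
def triZ (m : ℤ) : ℤ := m * (m - 1) / 2

lemma triZ_add_one (m : ℤ) : triZ (m + 1) = triZ m + m := by
  unfold triZ
  rw [show (m + 1) * (m + 1 - 1) = m * (m - 1) + m * 2 by ring, Int.add_mul_ediv_right _ _ two_ne_zero]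

lemma two_mul_triZ (m : ℤ) : 2 * triZ m = m * (m - 1) :=
  Int.mul_ediv_cancel' (by simpa [mul_comm] using (Int.even_mul_pred_self m).two_dvd)

/-- The coefficients of the finite triple product. -/
noncomputable def tripleTerm (x q : ℂ) (n : ℕ) (m : ℤ) : ℂ :=
  (-1) ^ m * x ^ m * q ^ triZ m * (qPochInv q (n - m) * qPochInv q (n + m))

lemma tripleTerm_eq_zero (x q : ℂ) {n : ℕ} {m : ℤ} (hm : m ∉ Finset.Icc (-n : ℤ) n) :
    tripleTerm x q n m = 0 := by
  rw [Finset.mem_Icc, not_and_or] at hm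
  rcases hm with h | h
  · rw [tripleTerm, qPochInv_of_neg q (k := n + m) (by omega)]; simp
  · rw [tripleTerm, qPochInv_of_neg q (k := n - m) (by omega)]; simp

lemma summable_tripleTerm (x q : ℂ) (n : ℕ) : Summable (tripleTerm x q n) :=
  summable_of_ne_finset_zero (s := Finset.Icc (-n : ℤ) n) fun _ hm => tripleTerm_eq_zero x q hm

/-- This is multiplication by `(1 - x q^n)(1 - q^{n+1}/x) = 1 + q^{2n+1} - x q^n - q^{n+1}/x`, read
off on the coefficients of a Laurent polynomial in `x`. -/
lemma tripleTerm_succ {x q : ℂ} (hq : ‖q‖ < 1) (hq0 : q ≠ 0) (hx : x ≠ 0) (n : ℕ) (m : ℤ) :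
    (1 - q ^ (2 * n + 1)) * (1 - q ^ (2 * n + 2)) * tripleTerm x q (n + 1) m =
      (1 + q ^ (2 * n + 1)) * tripleTerm x q n m - x * q ^ n * tripleTerm x q n (m - 1) -
        q ^ (n + 1) / x * tripleTerm x q n (m + 1) := by
  have e1 : qPochInv q (n - m) = (1 - q ^ (n + 1 - m : ℤ)) * qPochInv q (n + 1 - m) := by
    rw [← qPochInv_sub_one hq]; congr 1; ring
  have e2 : qPochInv q (n + m) = (1 - q ^ (n + 1 + m : ℤ)) * qPochInv q (n + 1 + m) := by
    rw [← qPochInv_sub_one hq]; congr 1; ring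
  have e3 : qPochInv q (n + (m - 1)) = (1 - q ^ (n + m : ℤ)) * qPochInv q (n + m) := by
    rw [← qPochInv_sub_one hq]; congr 1; ring
  have e4 : qPochInv q (n - (m + 1)) = (1 - q ^ (n - m : ℤ)) * qPochInv q (n - m) := by
    rw [← qPochInv_sub_one hq]; congr 1; ring
  have t1 : q ^ triZ (m + 1) = q ^ triZ m * q ^ m := by rw [triZ_add_one, zpow_add₀ hq0]
  have t2 : q ^ triZ (m - 1) = q ^ triZ m * q / q ^ m := by
    have := triZ_add_one (m - 1)
    rw [sub_add_cancel] at this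
    rw [this, zpow_add₀ hq0, zpow_sub_one₀ hq0]
    field_simp
  simp only [tripleTerm]
  rw [e3, e4, show (n : ℤ) - (m - 1) = n + 1 - m by ring, show (n : ℤ) + (m + 1) = n + 1 + m by ring,
    e1, e2, t1, t2, Nat.cast_add_one, zpow_add_one₀ (by norm_num : (-1 : ℂ) ≠ 0),
    zpow_sub_one₀ (by norm_num : (-1 : ℂ) ≠ 0), zpow_add_one₀ hx, zpow_sub_one₀ hx]
  simp only [zpow_sub₀ hq0, zpow_add₀ hq0, zpow_natCast, zpow_one]
  have hqm : q ^ m ≠ 0 := zpow_ne_zero _ hq0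
  generalize q ^ m = y at *
  field_simp
  ring

/-- The finite triple product. Summing the recurrence over all integers, the shifts of `m` drop out.
-/
lemma tsum_tripleTerm {x q : ℂ} (hq : ‖q‖ < 1) (hq0 : q ≠ 0) (hx : x ≠ 0) (n : ℕ) :
    qPoch q q (2 * n) * ∑' m, tripleTerm x q n m = qPoch x q n * qPoch (q / x) q n := by
  induction n with
  | zero =>
    rw [tsum_eq_single 0 fun m hm => tripleTerm_eq_zero x q (n := 0)
      (by simpa using hm)]
    have := qPochInv_natCast q 0
    simp only [Nat.cast_zero] at this
    simp [tripleTerm, triZ, this, qPoch_zero]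
  | succ n ih =>
    have s0 := summable_tripleTerm x q n
    have s1 : Summable fun m => tripleTerm x q n (m - 1) := 
      s0.comp_injective (sub_left_injective (b := (1 : ℤ)))
    have s2 : Summable fun m => tripleTerm x q n (m + 1) := 
      s0.comp_injective (add_left_injective (1 : ℤ))
    have k1 : ∑' m, tripleTerm x q n (m - 1) = ∑' m, tripleTerm x q n m :=
      (Equiv.subRight (1 : ℤ)).tsum_eq (tripleTerm x q n)
    have k2 : ∑' m, tripleTerm x q n (m + 1) = ∑' m, tripleTerm x q n m :=
      (Equiv.addRight (1 : ℤ)).tsum_eq (tripleTerm x q n)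
    have key : (1 - q ^ (2 * n + 1)) * (1 - q ^ (2 * n + 2)) * ∑' m, tripleTerm x q (n + 1) m =
        (1 + q ^ (2 * n + 1) - x * q ^ n - q ^ (n + 1) / x) * ∑' m, tripleTerm x q n m := by
      rw [← tsum_mul_left, tsum_congr fun m => tripleTerm_succ hq hq0 hx n m,
        ((s0.mul_left _).sub (s1.mul_left _)).tsum_sub (s2.mul_left _),
        (s0.mul_left _).tsum_sub (s1.mul_left _), tsum_mul_left, tsum_mul_left, tsum_mul_left, k1, k2]
      ring
    rw [show 2 * (n + 1) = 2 * n + 1 + 1 by ring, qPoch_self_succ, qPoch_self_succ, mul_assoc,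
      mul_assoc, ← mul_assoc (1 - q ^ (2 * n + 1)), key, mul_left_comm, ih, qPoch_succ x, qPoch_succ]
    field_simp
    ring

lemma exists_norm_qPochInv_le {q : ℂ} (hq : ‖q‖ < 1) :
    ∃ C : ℝ, 0 < C ∧ ∀ k, ‖qPochInv q k‖ ≤ C := by
  obtain ⟨C, hC, h⟩ := exists_norm_qPoch_inv_le hq (one_sub_self_mul_pow_ne_zero hq)
  refine ⟨C, hC, fun k => ?_⟩
  rw [qPochInv]
  split_ifs
  · simpa using hC.le
  · exact h _

lemma tendsto_qPochInv {q : ℂ} (hq : ‖q‖ < 1) {u : ℕ → ℤ} (hu : Tendsto u atTop atTop) :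
    Tendsto (fun n => qPochInv q (u n)) atTop (𝓝 (qInf q q)⁻¹) := by
  have h1 : Tendsto (fun n => (u n).toNat) atTop atTop :=
    tendsto_atTop.2 fun b => (hu.eventually_ge_atTop (b : ℤ)).mono fun n hn => by omega
  refine (((tendsto_qPoch hq q).inv₀ (qInf_self_ne_zero hq)).comp h1).congr' ?_
  filter_upwards [hu.eventually_ge_atTop 0] with n hn
  simp [qPochInv, not_lt.2 hn]

/-- The Jacobi triple product, given summability of the theta series. -/
theorem jacobi_triple_product {x q : ℂ} (hq : ‖q‖ < 1) (hq0 : q ≠ 0) (hx : x ≠ 0)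
    (hs : Summable fun m : ℤ => ‖(-1) ^ m * x ^ m * q ^ triZ m‖) :
    ∑' m : ℤ, (-1) ^ m * x ^ m * q ^ triZ m = qInf q q * qInf x q * qInf (q / x) q := by
  obtain ⟨C, hC, hCb⟩ := exists_norm_qPochInv_le hq
  have hqi := qInf_self_ne_zero hq
  have hlim : Tendsto (fun n => ∑' m, tripleTerm x q n m) atTop
      (𝓝 (∑' m : ℤ, (-1) ^ m * x ^ m * q ^ triZ m * ((qInf q q)⁻¹ * (qInf q q)⁻¹))) := by
    refine tendsto_tsum_of_dominated_convergence (hs.mul_right (C * C)) (fun m => ?_)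
      (.of_forall fun n m => ?_)
    · have a1 : Tendsto (fun n : ℕ => (n : ℤ) - m) atTop atTop :=
        tendsto_atTop_add_const_right _ (-m) tendsto_natCast_atTop_atTop
      have a2 : Tendsto (fun n : ℕ => (n : ℤ) + m) atTop atTop :=
        tendsto_atTop_add_const_right _ m tendsto_natCast_atTop_atTop
      exact ((tendsto_qPochInv hq a1).mul (tendsto_qPochInv hq a2)).const_mul _
    · rw [tripleTerm, norm_mul _ (qPochInv q _ * _), norm_mul (qPochInv q _)]
      gcongr
      · exact hCb _
      · exact hCb _
  have h1 := ((tendsto_qPoch hq q).comp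
    (tendsto_atTop_mono (fun n => by omega : ∀ n : ℕ, n ≤ 2 * n) tendsto_id)).mul hlim
  simp only [Function.comp_def, tsum_tripleTerm hq hq0 hx] at h1
  have h2 := (tendsto_qPoch hq x).mul (tendsto_qPoch hq (q / x))
  have e := tendsto_nhds_unique h1 h2
  rw [tsum_mul_right] at e
  rw [mul_assoc, ← e]
  field_simp

/-! ### The odd theta function -/

lemma exp_int_mul_pi_mul_I (n : ℤ) : Complex.exp (n * (Real.pi * Complex.I)) = (-1) ^ n := by
  rw [Complex.exp_int_mul, Complex.exp_pi_mul_I]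

lemma norm_exp_two_pi_mul_I_mul_lt_one {τ : ℂ} (hτ : 0 < τ.im) :
    ‖Complex.exp (2 * Real.pi * Complex.I * τ)‖ < 1 := by
  rw [Complex.norm_exp, Real.exp_lt_one_iff]
  simp only [Complex.mul_re, Complex.mul_im, Complex.I_re, Complex.I_im, Complex.ofReal_re,
    Complex.ofReal_im, Complex.re_ofNat, Complex.im_ofNat]
  have := mul_pos Real.pi_pos hτ
  nlinarith

/-- Completing the square after `n ↦ n + 1`, with the sign `(-1)^n` absorbed by the shift `1/2`. All
analytic properties of `oddTheta` are taken from `jacobiTheta₂` this way. -/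
lemma oddTheta_eq_jacobiTheta₂ (z τ : ℂ) :
    oddTheta z τ = Complex.exp (Real.pi * Complex.I * (τ / 4 - z)) *
      jacobiTheta₂ (z - τ / 2 + 1 / 2) τ := by
  rw [oddTheta, jacobiTheta₂, ← tsum_mul_left, ← tsum_neg]
  conv_rhs => rw [← (Equiv.addRight (1 : ℤ)).tsum_eq]
  refine tsum_congr fun n => ?_
  rw [Equiv.coe_addRight, jacobiTheta₂_term, ← exp_int_mul_pi_mul_I, ← neg_one_mul,
    ← Complex.exp_pi_mul_I, ← Complex.exp_add, ← Complex.exp_add, ← Complex.exp_add,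
    ← Complex.exp_add]
  congr 1
  push_cast
  ring

lemma jacobiTheta₂_term_eq_triple (n : ℤ) (z τ : ℂ) :
    jacobiTheta₂_term n (z - τ / 2 + 1 / 2) τ =
      (-1) ^ n * Complex.exp (2 * Real.pi * Complex.I * z) ^ n *
        Complex.exp (2 * Real.pi * Complex.I * τ) ^ triZ n := by
  rw [jacobiTheta₂_term, ← exp_int_mul_pi_mul_I, ← Complex.exp_int_mul, ← Complex.exp_int_mul,
    ← Complex.exp_add, ← Complex.exp_add]
  have h : (2 : ℂ) * (triZ n : ℂ) = n * (n - 1) := by exact_mod_cast two_mul_triZ n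
  congr 1
  linear_combination (-(Real.pi * Complex.I * τ)) * h

/-- The Jacobi triple product for `jacobiTheta₂`. -/
lemma jacobiTheta₂_eq_prod (z : ℂ) {τ : ℂ} (hτ : 0 < τ.im) :
    jacobiTheta₂ (z - τ / 2 + 1 / 2) τ =
      qInf (Complex.exp (2 * Real.pi * Complex.I * τ)) (Complex.exp (2 * Real.pi * Complex.I * τ)) *
      qInf (Complex.exp (2 * Real.pi * Complex.I * z)) (Complex.exp (2 * Real.pi * Complex.I * τ)) *
      qInf (Complex.exp (2 * Real.pi * Complex.I * τ) / Complex.exp (2 * Real.pi * Complex.I * z))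
        (Complex.exp (2 * Real.pi * Complex.I * τ)) := by
  rw [jacobiTheta₂, tsum_congr fun n => jacobiTheta₂_term_eq_triple n z τ]
  refine jacobi_triple_product (norm_exp_two_pi_mul_I_mul_lt_one hτ) (Complex.exp_ne_zero _)
    (Complex.exp_ne_zero _) ?_
  have := ((summable_jacobiTheta₂_term_iff (z - τ / 2 + 1 / 2) τ).2 hτ).norm
  simpa only [jacobiTheta₂_term_eq_triple] using this

lemma oddTheta_eq_prod (z : ℂ) {τ : ℂ} (hτ : 0 < τ.im) :
    oddTheta z τ = Complex.exp (Real.pi * Complex.I * (τ / 4 - z)) * (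
      qInf (Complex.exp (2 * Real.pi * Complex.I * τ)) (Complex.exp (2 * Real.pi * Complex.I * τ)) *
      qInf (Complex.exp (2 * Real.pi * Complex.I * z)) (Complex.exp (2 * Real.pi * Complex.I * τ)) *
      qInf (Complex.exp (2 * Real.pi * Complex.I * τ) / Complex.exp (2 * Real.pi * Complex.I * z))
        (Complex.exp (2 * Real.pi * Complex.I * τ))) := by
  rw [oddTheta_eq_jacobiTheta₂, jacobiTheta₂_eq_prod z hτ]

lemma pairFactor_exp_ne_zero {z τ : ℂ} (h : ∀ n m : ℤ, z ≠ n * τ + m) (k : ℕ) :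
    pairFactor (Complex.exp (2 * Real.pi * Complex.I * z))
      (Complex.exp (2 * Real.pi * Complex.I * τ)) k ≠ 0 := by
  rw [pairFactor, ← Complex.exp_sub, ← Complex.exp_nat_mul, ← Complex.exp_add, ← Complex.exp_add]
  have hne := Complex.two_pi_I_ne_zero
  refine mul_ne_zero (fun e => ?_) (fun e => ?_)
  · obtain ⟨n, hn⟩ := Complex.exp_eq_one_iff.1 (sub_eq_zero.1 e).symm
    refine h (-k) n (mul_left_cancel₀ hne ?_)
    push_cast
    linear_combination hn
  · obtain ⟨n, hn⟩ := Complex.exp_eq_one_iff.1 (sub_eq_zero.1 e).symm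
    refine h (k + 1) (-n) (mul_left_cancel₀ hne ?_)
    push_cast
    linear_combination -hn

lemma qInf_ne_zero_of_pairFactor {w q : ℂ} (hq : ‖q‖ < 1) (h : ∀ k, pairFactor w q k ≠ 0) :
    qInf w q ≠ 0 ∧ qInf (q / w) q ≠ 0 :=
  ⟨qInf_ne_zero hq fun k => left_ne_zero_of_mul (h k),
    qInf_ne_zero hq fun k => right_ne_zero_of_mul (h k)⟩

lemma oddTheta_ne_zero {z τ : ℂ} (hτ : 0 < τ.im) (h : ∀ n m : ℤ, z ≠ n * τ + m) :
    oddTheta z τ ≠ 0 := by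
  have hq := norm_exp_two_pi_mul_I_mul_lt_one hτ
  obtain ⟨h1, h2⟩ := qInf_ne_zero_of_pairFactor hq (pairFactor_exp_ne_zero h)
  rw [oddTheta_eq_prod z hτ]
  exact mul_ne_zero (Complex.exp_ne_zero _) (mul_ne_zero (mul_ne_zero (qInf_self_ne_zero hq) h1) h2)

/-- Reindex by `n ↦ n + l`; the exponents then differ by `2πi n m`. -/
lemma jacobiTheta₂_add_lattice (l m : ℤ) (z τ : ℂ) :
    jacobiTheta₂ (z + l * τ + m) τ =
      Complex.exp (-(Real.pi * Complex.I * (l ^ 2 * τ + 2 * l * z))) * jacobiTheta₂ z τ := by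
  conv_rhs => rw [jacobiTheta₂, ← tsum_mul_left, ← (Equiv.addRight l).tsum_eq]
  refine tsum_congr fun n => ?_
  rw [Equiv.coe_addRight, jacobiTheta₂_term, jacobiTheta₂_term, ← Complex.exp_add]
  refine Complex.exp_eq_exp_iff_exists_int.2 ⟨n * m, ?_⟩
  push_cast
  ring

/-- Quasi-periodicity of the odd theta function. -/
lemma oddTheta_add_lattice (l m : ℤ) (z τ : ℂ) :
    oddTheta (z + l * τ + m) τ = (-1) ^ (l + m) *
      Complex.exp (-(Real.pi * Complex.I * (l ^ 2 * τ + 2 * l * z))) * oddTheta z τ := by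
  rw [oddTheta_eq_jacobiTheta₂, oddTheta_eq_jacobiTheta₂,
    show z + l * τ + m - τ / 2 + 1 / 2 = (z - τ / 2 + 1 / 2) + l * τ + m by ring,
    jacobiTheta₂_add_lattice, ← mul_assoc, ← mul_assoc, ← exp_int_mul_pi_mul_I, ← Complex.exp_add,
    ← Complex.exp_add, ← Complex.exp_add]
  congr 1
  refine Complex.exp_eq_exp_iff_exists_int.2 ⟨-(l + m), ?_⟩
  push_cast
  ring

/-- At `u = (1 - τ)/2` one has `u + τ - 1 = -u`: quasi-periodicity yields the factor `-1` and
evenness the factor `1`, so `jacobiTheta₂` vanishes there. -/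
lemma oddTheta_zero_left (τ : ℂ) : oddTheta 0 τ = 0 := by
  have h := jacobiTheta₂_add_lattice 1 (-1) (0 - τ / 2 + 1 / 2) τ
  rw [show 0 - τ / 2 + 1 / 2 + (1 : ℤ) * τ + (-1 : ℤ) = -(0 - τ / 2 + 1 / 2) by push_cast; ring,
    jacobiTheta₂_neg_left, show -(Real.pi * Complex.I * (((1 : ℤ) : ℂ) ^ 2 * τ +
      2 * ((1 : ℤ) : ℂ) * (0 - τ / 2 + 1 / 2))) = -(Real.pi * Complex.I) by push_cast; ring,
    Complex.exp_neg, Complex.exp_pi_mul_I] at h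
  rw [oddTheta_eq_jacobiTheta₂]
  have h0 : jacobiTheta₂ (0 - τ / 2 + 1 / 2) τ = 0 := by linear_combination h / 2
  rw [h0, mul_zero]

lemma oddTheta_lattice (n m : ℤ) (τ : ℂ) : oddTheta (n * τ + m) τ = 0 := by
  have := oddTheta_add_lattice n m 0 τ
  rwa [zero_add, oddTheta_zero_left, mul_zero] at this

lemma oddTheta_eq_zero_iff {z τ : ℂ} (hτ : 0 < τ.im) :
    oddTheta z τ = 0 ↔ ∃ n m : ℤ, z = n * τ + m := by
  refine ⟨fun h => by_contra fun h' => oddTheta_ne_zero hτ (fun n m e => h' ⟨n, m, e⟩) h, ?_⟩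
  rintro ⟨n, m, rfl⟩
  exact oddTheta_lattice n m τ

lemma oddTheta_add_one_right (z τ : ℂ) :
    oddTheta z (τ + 1) = Complex.exp (Real.pi * Complex.I / 4) * oddTheta z τ := by
  rw [oddTheta, oddTheta, mul_neg, ← tsum_mul_left]
  congr 1
  refine tsum_congr fun n => ?_
  obtain ⟨k, hk⟩ := (Int.even_mul_succ_self n).two_dvd
  have hk' : (n : ℂ) * (n + 1) = 2 * k := by exact_mod_cast hk
  rw [mul_left_comm, ← Complex.exp_add]
  congr 1
  refine Complex.exp_eq_exp_iff_exists_int.2 ⟨k, ?_⟩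
  linear_combination Real.pi * Complex.I * hk'

lemma oddTheta_div_neg_one_div (z : ℂ) {τ : ℂ} (hτ : 0 < τ.im) :
    oddTheta (z / τ) (-1 / τ) = -Complex.I * (-Complex.I * τ) ^ (1 / 2 : ℂ) *
      Complex.exp (Real.pi * Complex.I * z ^ 2 / τ) * oddTheta z τ := by
  have hτ0 : τ ≠ 0 := by rintro rfl; simp at hτ
  have hs : (-Complex.I * τ) ^ (1 / 2 : ℂ) ≠ 0 := by
    rw [Ne, Complex.cpow_eq_zero_iff]; simp [hτ0]
  rw [oddTheta_eq_jacobiTheta₂, oddTheta_eq_jacobiTheta₂,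
    jacobiTheta₂_functional_equation (z - τ / 2 + 1 / 2) τ,
    -- The half-period shift is not preserved by `τ ↦ -1/τ`, but the discrepancy is the period 1.
    show z / τ - -1 / τ / 2 + 1 / 2 = (z - τ / 2 + 1 / 2) / τ + 1 by field_simp; ring,
    jacobiTheta₂_add_left]
  have e : Complex.exp (Real.pi * Complex.I * (-1 / τ / 4 - z / τ)) =
      -Complex.I * Complex.exp (Real.pi * Complex.I * z ^ 2 / τ) *
      Complex.exp (Real.pi * Complex.I * (τ / 4 - z)) *
      Complex.exp (-Real.pi * Complex.I * (z - τ / 2 + 1 / 2) ^ 2 / τ) := by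
    rw [← Complex.exp_neg_pi_div_two_mul_I, ← Complex.exp_add, ← Complex.exp_add, ← Complex.exp_add]
    congr 1
    field_simp
    ring
  rw [e]
  field_simp

/-! ### Joint analyticity of the theta function -/

/-- The character `ζ ↦ exp (2 π i n ζ)` as a continuous function on the unit circle around `c`. -/
noncomputable def circleChar (c : ℂ) (n : ℤ) : C(Metric.sphere c 1, ℂ) where
  toFun ζ := Complex.exp (2 * Real.pi * Complex.I * n * ζ)

lemma exp_mul_circleChar (c : ℂ) (n : ℤ) (τ : ℂ) (ζ : Metric.sphere c 1) :
    (Complex.exp (Real.pi * Complex.I * n ^ 2 * τ) • circleChar c n) ζ =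
      jacobiTheta₂_term n ζ τ := by
  rw [jacobiTheta₂_term, Complex.exp_add, mul_comm (Complex.exp (2 * _ * _ * _ * _))]
  rfl

/-- On the circle `|Im ζ| ≤ |Im c| + 1`, so the sup norm is bounded uniformly for `Im τ ≥ T`. -/
lemma norm_exp_mul_circleChar_le (c : ℂ) {T : ℝ} (hT : 0 < T) {τ : ℂ} (hτ : T ≤ τ.im) (n : ℤ) :
    ‖Complex.exp (Real.pi * Complex.I * n ^ 2 * τ) • circleChar c n‖ ≤
      Real.exp (-Real.pi * (T * n ^ 2 - 2 * (|c.im| + 1) * |n|)) := by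
  refine (ContinuousMap.norm_le _ (Real.exp_pos _).le).2 fun ζ => ?_
  rw [exp_mul_circleChar]
  refine norm_jacobiTheta₂_term_le hT ?_ hτ n
  have h1 : ‖(ζ : ℂ) - c‖ = 1 := mem_sphere_iff_norm.1 ζ.2
  have h2 := Complex.abs_im_le_norm ((ζ : ℂ) - c)
  rw [h1, Complex.sub_im] at h2
  have h3 := abs_add_le ((ζ : ℂ).im - c.im) c.im
  rw [sub_add_cancel] at h3
  linarith

lemma summable_circleChar_bound (c : ℂ) {T : ℝ} (hT : 0 < T) :
    Summable fun n : ℤ => Real.exp (-Real.pi * (T * n ^ 2 - 2 * (|c.im| + 1) * |n|)) := by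
  simpa using summable_pow_mul_jacobiTheta₂_term_bound (|c.im| + 1) hT 0

/-- The restriction of `jacobiTheta₂ · τ` to the unit circle around `c`. -/
noncomputable def circleTheta (c τ : ℂ) : C(Metric.sphere c 1, ℂ) :=
  ∑' n : ℤ, Complex.exp (Real.pi * Complex.I * n ^ 2 * τ) • circleChar c n

lemma circleTheta_apply (c : ℂ) {τ : ℂ} (hτ : 0 < τ.im) (ζ : Metric.sphere c 1) :
    circleTheta c τ ζ = jacobiTheta₂ ζ τ := by
  have hs : Summable fun n : ℤ => Complex.exp (Real.pi * Complex.I * n ^ 2 * τ) • circleChar c n :=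
    .of_norm_bounded (summable_circleChar_bound c hτ) (norm_exp_mul_circleChar_le c hτ le_rfl)
  rw [circleTheta, ← ContinuousMap.tsum_apply hs, jacobiTheta₂]
  exact tsum_congr fun n => exp_mul_circleChar c n τ ζ

/-- For a Banach space valued function of one complex variable, differentiability on an open set
gives analyticity; on `Im t > Im τ / 2` one majorant serves the whole series. -/
lemma analyticAt_circleTheta (c : ℂ) {τ : ℂ} (hτ : 0 < τ.im) : AnalyticAt ℂ (circleTheta c) τ := by
  have ho : IsOpen {t : ℂ | τ.im / 2 < t.im} := isOpen_lt continuous_const Complex.continuous_im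
  refine DifferentiableOn.analyticAt (s := {t : ℂ | τ.im / 2 < t.im}) ?_
    (ho.mem_nhds (by simpa using hτ))
  refine Complex.differentiableOn_tsum_of_summable_norm
    (summable_circleChar_bound c (half_pos hτ)) (fun n => ?_) ho
    fun n t ht => norm_exp_mul_circleChar_le c (half_pos hτ) (le_of_lt ht) n
  exact ((by fun_prop : Differentiable ℂ fun t : ℂ =>
    Complex.exp (Real.pi * Complex.I * n ^ 2 * t)).smul_const _).differentiableOn

/-- The contour integral over the unit circle around `c` as a continuous linear form. -/
noncomputable def circleForm (c : ℂ) : C(Metric.sphere c 1, ℂ) →L[ℂ] ℂ :=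
  LinearMap.mkContinuous
    { toFun := fun f => ∫ θ in (0 : ℝ)..2 * Real.pi,
        deriv (circleMap c 1) θ * f ⟨circleMap c 1 θ, circleMap_mem_sphere c zero_le_one θ⟩
      map_add' := fun f g => by
        rw [← intervalIntegral.integral_add]
        · simp [mul_add]
        all_goals
          refine Continuous.intervalIntegrable ?_ _ _
          simp only [deriv_circleMap]
          fun_prop
      map_smul' := fun a f => by
        rw [RingHom.id_apply, smul_eq_mul, ← intervalIntegral.integral_const_mul]
        simp [mul_left_comm] }
    (2 * Real.pi) fun f => by
      have := intervalIntegral.norm_integral_le_of_norm_le_const (a := 0) (b := 2 * Real.pi)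
        (f := fun θ => deriv (circleMap c 1) θ *
          f ⟨circleMap c 1 θ, circleMap_mem_sphere c zero_le_one θ⟩) (C := ‖f‖) fun θ _ => by
        rw [norm_mul, deriv_circleMap]
        simpa using f.norm_coe_le_norm _
      rw [sub_zero, abs_of_pos Real.two_pi_pos, mul_comm ‖f‖] at this
      exact this

/-- The inclusion of the unit circle around `c`. -/
def circleIncl (c : ℂ) : C(Metric.sphere c 1, ℂ) := ⟨Subtype.val, continuous_subtype_val⟩

lemma isUnit_circleIncl_sub {c z : ℂ} (hz : z ∈ Metric.ball c 1) :
    IsUnit (circleIncl c - algebraMap ℂ _ z) := by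
  refine (ContinuousMap.isUnit_iff_forall_ne_zero _).2 fun ζ h => ?_
  have e : (ζ : ℂ) = z := sub_eq_zero.1 h
  have := ζ.2
  rw [e, Metric.mem_sphere] at this
  exact (Metric.mem_ball.1 hz).ne this

lemma inverse_circleIncl_sub_apply {c z : ℂ} (hz : z ∈ Metric.ball c 1) (ζ : Metric.sphere c 1) :
    Ring.inverse (circleIncl c - algebraMap ℂ _ z) ζ = ((ζ : ℂ) - z)⁻¹ := by
  refine eq_inv_of_mul_eq_one_right ?_
  exact congrArg (fun f : C(Metric.sphere c 1, ℂ) => f ζ)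
    (Ring.mul_inverse_cancel _ (isUnit_circleIncl_sub hz))

/-- Cauchy's formula separates the variables: `z` enters only through the kernel and `τ` only
through `circleTheta`, both elements of one Banach algebra, and the integral is a continuous linear
form. Joint analyticity follows by composition. -/
lemma circleForm_cauchy {c z τ : ℂ} (hz : z ∈ Metric.ball c 1) (hτ : 0 < τ.im) :
    (2 * Real.pi * Complex.I)⁻¹ * circleForm c
      (Ring.inverse (circleIncl c - algebraMap ℂ _ z) * circleTheta c τ) = jacobiTheta₂ z τ := by
  have hd : Differentiable ℂ fun ζ => jacobiTheta₂ ζ τ := fun ζ => differentiableAt_jacobiTheta₂_fst ζ hτ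
  rw [← hd.diffContOnCl.two_pi_i_inv_smul_circleIntegral_sub_inv_smul hz, smul_eq_mul]
  congr 1
  refine intervalIntegral.integral_congr fun θ _ => ?_
  simp only [smul_eq_mul]
  congr 1
  rw [ContinuousMap.mul_apply, inverse_circleIncl_sub_apply hz, circleTheta_apply c hτ]

/-- `jacobiTheta₂` is jointly analytic. -/
theorem analyticAt_jacobiTheta₂ (z : ℂ) {τ : ℂ} (hτ : 0 < τ.im) :
    AnalyticAt ℂ (fun p : ℂ × ℂ => jacobiTheta₂ p.1 p.2) (z, τ) := by
  have hz : z ∈ Metric.ball z 1 := Metric.mem_ball_self one_pos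
  obtain ⟨u, hu⟩ := isUnit_circleIncl_sub hz
  have a1 : AnalyticAt ℂ (fun p : ℂ × ℂ => circleTheta z p.2) (z, τ) :=
    (analyticAt_circleTheta z hτ).comp_of_eq analyticAt_snd rfl
  have a2 : AnalyticAt ℂ (fun p : ℂ × ℂ =>
      circleIncl z - algebraMap ℂ C(Metric.sphere z 1, ℂ) p.1) (z, τ) := by
    refine analyticAt_const.sub ?_
    exact ((Algebra.linearMap ℂ C(Metric.sphere z 1, ℂ)).toContinuousLinearMap.analyticAt z).comp_of_eq
      analyticAt_fst rfl
  -- Inversion in a Banach algebra is analytic at units, and `ζ - z` is a unit because the centre is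
  -- off the circle.
  have a3 : AnalyticAt ℂ (fun p : ℂ × ℂ => Ring.inverse
      (circleIncl z - algebraMap ℂ C(Metric.sphere z 1, ℂ) p.1)) (z, τ) :=
    (analyticAt_inverse (𝕜 := ℂ) u).comp_of_eq a2 hu.symm
  have a4 : AnalyticAt ℂ (fun p : ℂ × ℂ => (2 * Real.pi * Complex.I)⁻¹ * circleForm z
      (Ring.inverse (circleIncl z - algebraMap ℂ _ p.1) * circleTheta z p.2)) (z, τ) :=
    analyticAt_const.mul (((circleForm z).analyticAt _).comp_of_eq (a3.mul a1) rfl)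
  refine a4.congr ?_
  have h1 : ∀ᶠ p : ℂ × ℂ in 𝓝 (z, τ), p.1 ∈ Metric.ball z 1 :=
    continuous_fst.continuousAt.eventually (Metric.isOpen_ball.mem_nhds hz)
  have h2 : ∀ᶠ p : ℂ × ℂ in 𝓝 (z, τ), 0 < p.2.im :=
    (Complex.continuous_im.comp continuous_snd).continuousAt.eventually (lt_mem_nhds hτ)
  filter_upwards [h1, h2] with p hp1 hp2 using circleForm_cauchy hp1 hp2

lemma analyticAt_oddTheta (z : ℂ) {τ : ℂ} (hτ : 0 < τ.im) :
    AnalyticAt ℂ (fun p : ℂ × ℂ => oddTheta p.1 p.2) (z, τ) := by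
  simp only [oddTheta_eq_jacobiTheta₂]
  have h1 : AnalyticAt ℂ (fun p : ℂ × ℂ => p.1) (z, τ) := analyticAt_fst
  have h2 : AnalyticAt ℂ (fun p : ℂ × ℂ => p.2) (z, τ) := analyticAt_snd
  refine AnalyticAt.mul (AnalyticAt.cexp (analyticAt_const.mul
    ((h2.div_const).sub h1))) ?_
  exact (analyticAt_jacobiTheta₂ (z - τ / 2 + 1 / 2) hτ).comp_of_eq
    (f := fun p : ℂ × ℂ => (p.1 - p.2 / 2 + 1 / 2, p.2))
    (((h1.sub h2.div_const).add analyticAt_const).prod h2) rfl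

/-! ### Modular transformations -/

lemma coe_sl_smul (γ : SL(2, ℤ)) (τ : ℍ) :
    ((γ • τ : ℍ) : ℂ) = (((γ 0 0 : ℤ) : ℂ) * τ + ((γ 0 1 : ℤ) : ℂ)) / autDenom γ τ := by
  rw [UpperHalfPlane.coe_specialLinearGroup_apply]
  simp [autDenom]

lemma autDenom_ne_zero (γ : SL(2, ℤ)) (τ : ℍ) : autDenom γ τ ≠ 0 := by
  rw [autDenom, ← ModularGroup.denom_apply]
  exact UpperHalfPlane.denom_ne_zero _ τ

lemma sl_det (γ : SL(2, ℤ)) : γ 0 0 * γ 1 1 - γ 0 1 * γ 1 0 = 1 := by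
  rw [← Matrix.det_fin_two]; exact γ.2

lemma sl_det_complex (γ : SL(2, ℤ)) :
    ((γ 0 0 : ℤ) : ℂ) * ((γ 1 1 : ℤ) : ℂ) - ((γ 0 1 : ℤ) : ℂ) * ((γ 1 0 : ℤ) : ℂ) = 1 := by
  exact_mod_cast sl_det γ

lemma sl_mul_one_zero (γ δ : SL(2, ℤ)) :
    (γ * δ) 1 0 = γ 1 0 * δ 0 0 + γ 1 1 * δ 1 0 := by
  simp [Matrix.SpecialLinearGroup.coe_mul, Matrix.mul_apply, Fin.sum_univ_two]

lemma sl_mul_one_one (γ δ : SL(2, ℤ)) :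
    (γ * δ) 1 1 = γ 1 0 * δ 0 1 + γ 1 1 * δ 1 1 := by
  simp [Matrix.SpecialLinearGroup.coe_mul, Matrix.mul_apply, Fin.sum_univ_two]

lemma autDenom_mul (γ δ : SL(2, ℤ)) (τ : ℍ) :
    autDenom (γ * δ) τ = autDenom γ (δ • τ) * autDenom δ τ := by
  have h := autDenom_ne_zero δ τ
  rw [autDenom, autDenom, coe_sl_smul, sl_mul_one_zero, sl_mul_one_one]
  push_cast
  field_simp
  rw [autDenom]
  ring

lemma autDenom_one (τ : ℍ) : autDenom 1 τ = 1 := by simp [autDenom]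

lemma autDenom_inv_smul (γ : SL(2, ℤ)) (τ : ℍ) :
    autDenom γ (γ⁻¹ • τ) * autDenom γ⁻¹ τ = 1 := by
  rw [← autDenom_mul, mul_inv_cancel, autDenom_one]

lemma continuous_autDenom (γ : SL(2, ℤ)) : Continuous (autDenom γ) := by
  unfold autDenom
  exact (continuous_const.mul UpperHalfPlane.continuous_coe).add continuous_const

lemma continuous_sl_smul (γ : SL(2, ℤ)) : Continuous fun τ : ℍ => γ • τ := by
  refine UpperHalfPlane.isOpenEmbedding_coe.isEmbedding.continuous_iff.2 ?_
  simp only [Function.comp_def, coe_sl_smul]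
  exact ((continuous_const.mul UpperHalfPlane.continuous_coe).add continuous_const).div
    (continuous_autDenom γ) (autDenom_ne_zero γ)

/-- `oddTheta` transforms under `γ` like a Jacobi form of weight and index `1/2`, up to an eighth
root of unity. -/
def OddThetaTransforms (γ : SL(2, ℤ)) : Prop :=
  ∃ J : ℍ → ℂ, Continuous J ∧ (∀ τ, J τ ^ 8 = autDenom γ τ ^ 4) ∧
    ∀ (z : ℂ) (τ : ℍ), oddTheta (z / autDenom γ τ) ((γ • τ : ℍ) : ℂ) =
      J τ * Complex.exp (Real.pi * Complex.I * ((γ 1 0 : ℤ) : ℂ) * z ^ 2 / autDenom γ τ) *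
        oddTheta z τ

lemma ne_zero_of_pow_eight {x y : ℂ} (h : x ^ 8 = y ^ 4) (hy : y ≠ 0) : x ≠ 0 := by
  rintro rfl
  exact pow_ne_zero 4 hy (by simpa using h.symm)

lemma OddThetaTransforms.one : OddThetaTransforms 1 :=
  ⟨fun _ => 1, continuous_const, fun τ => by simp [autDenom_one], fun z τ => by
    simp [autDenom_one]⟩

lemma OddThetaTransforms.mul {γ δ : SL(2, ℤ)} (hγ : OddThetaTransforms γ)
    (hδ : OddThetaTransforms δ) : OddThetaTransforms (γ * δ) := by
  obtain ⟨J, hJ, hJ8, h⟩ := hγ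
  obtain ⟨K, hK, hK8, h'⟩ := hδ
  refine ⟨fun τ => J (δ • τ) * K τ, (hJ.comp (continuous_sl_smul δ)).mul hK, fun τ => ?_,
    fun z τ => ?_⟩
  · rw [mul_pow, hJ8, hK8, autDenom_mul, mul_pow]
  · have n1 := autDenom_ne_zero δ τ
    have n2 := autDenom_ne_zero γ (δ • τ)
    rw [mul_smul, autDenom_mul, mul_comm (autDenom γ _), ← div_div, h, h']
    have e : Complex.exp (Real.pi * Complex.I * (((γ * δ) 1 0 : ℤ) : ℂ) * z ^ 2 /
        (autDenom δ τ * autDenom γ (δ • τ))) =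
        Complex.exp (Real.pi * Complex.I * ((γ 1 0 : ℤ) : ℂ) * (z / autDenom δ τ) ^ 2 /
          autDenom γ (δ • τ)) *
        Complex.exp (Real.pi * Complex.I * ((δ 1 0 : ℤ) : ℂ) * z ^ 2 / autDenom δ τ) := by
      rw [← Complex.exp_add]
      congr 1
      -- The cocycle relation for `c z² / (cτ + d)`, a consequence of `det δ = 1`.
      have key : (((γ * δ) 1 0 : ℤ) : ℂ) * autDenom δ τ =
          ((γ 1 0 : ℤ) : ℂ) + ((δ 1 0 : ℤ) : ℂ) * (autDenom γ (δ • τ) * autDenom δ τ) := by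
        rw [← autDenom_mul, autDenom, autDenom, sl_mul_one_zero, sl_mul_one_one]
        push_cast
        linear_combination ((γ 1 0 : ℤ) : ℂ) * sl_det_complex δ
      field_simp
      linear_combination z ^ 2 * key
    rw [e]
    ring

lemma OddThetaTransforms.inv {γ : SL(2, ℤ)} (hγ : OddThetaTransforms γ) :
    OddThetaTransforms γ⁻¹ := by
  obtain ⟨J, hJ, hJ8, h⟩ := hγ
  have hJ0 : ∀ τ, J τ ≠ 0 := fun τ => ne_zero_of_pow_eight (hJ8 τ) (autDenom_ne_zero γ τ)
  refine ⟨fun τ => (J (γ⁻¹ • τ))⁻¹, (hJ.comp (continuous_sl_smul γ⁻¹)).inv₀ fun τ => hJ0 _,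
    fun τ => ?_, fun z τ => ?_⟩
  · have e := autDenom_inv_smul γ τ
    rw [inv_pow, hJ8, ← inv_pow, eq_inv_of_mul_eq_one_right e]
  · have e := eq_inv_of_mul_eq_one_right (autDenom_inv_smul γ τ)
    have hD := autDenom_ne_zero γ (γ⁻¹ • τ)
    -- The law for `γ` at `γ⁻¹ τ`, with the elliptic variable rescaled so that the left side becomes
    -- `ϑ(z; τ)`.
    have hk := h (z * autDenom γ (γ⁻¹ • τ)) (γ⁻¹ • τ)
    rw [smul_inv_smul, mul_div_cancel_right₀ _ hD] at hk
    have hc : ((γ⁻¹ 1 0 : ℤ) : ℂ) = -((γ 1 0 : ℤ) : ℂ) := by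
      rw [Matrix.SpecialLinearGroup.SL2_inv_expl]; simp
    rw [e, div_inv_eq_mul, hk, hc, div_inv_eq_mul]
    have e2 : Complex.exp (Real.pi * Complex.I * -((γ 1 0 : ℤ) : ℂ) * z ^ 2 *
        autDenom γ (γ⁻¹ • τ)) * Complex.exp (Real.pi * Complex.I * ((γ 1 0 : ℤ) : ℂ) *
        (z * autDenom γ (γ⁻¹ • τ)) ^ 2 / autDenom γ (γ⁻¹ • τ)) = 1 := by
      rw [← Complex.exp_add, Complex.exp_eq_one_iff]
      refine ⟨0, ?_⟩
      field_simp
      push_cast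
      ring
    have h0 := hJ0 (γ⁻¹ • τ)
    calc _ = (J (γ⁻¹ • τ))⁻¹ * J (γ⁻¹ • τ) * 1 * oddTheta (z * autDenom γ (γ⁻¹ • τ))
          ((γ⁻¹ • τ : ℍ) : ℂ) := by rw [inv_mul_cancel₀ h0]; ring
      _ = _ := by rw [← e2]; ring

lemma OddThetaTransforms.S : OddThetaTransforms ModularGroup.S := by
  have hd : ∀ τ : ℍ, autDenom ModularGroup.S τ = τ := fun τ => by simp [autDenom, ModularGroup.S]
  have hc : ModularGroup.S 1 0 = 1 := by simp [ModularGroup.S]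
  have hs : ∀ τ : ℍ, -Complex.I * (τ : ℂ) ∈ Complex.slitPlane := fun τ => by
    refine Or.inl ?_
    simpa using τ.im_pos
  refine ⟨fun τ => -Complex.I * (-Complex.I * (τ : ℂ)) ^ (1 / 2 : ℂ), ?_, fun τ => ?_, fun z τ => ?_⟩
  · exact continuous_const.mul (Continuous.cpow (continuous_const.mul UpperHalfPlane.continuous_coe)
      continuous_const hs)
  · rw [hd, mul_pow, ← Complex.cpow_nat_mul, show ((8 : ℕ) : ℂ) * (1 / 2) = (4 : ℕ) by norm_num,
      Complex.cpow_natCast, mul_pow, show (-Complex.I) ^ 8 = ((Complex.I ^ 2) ^ 2) ^ 2 by ring,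
      show (-Complex.I) ^ 4 = (Complex.I ^ 2) ^ 2 by ring, Complex.I_sq]
    norm_num
  · rw [hd, coe_sl_smul, hd, hc]
    have : ((ModularGroup.S 0 0 : ℤ) : ℂ) * (τ : ℂ) + ((ModularGroup.S 0 1 : ℤ) : ℂ) = -1 := by
      simp [ModularGroup.S]
    rw [this, oddTheta_div_neg_one_div z τ.im_pos, Int.cast_one, mul_one]

lemma OddThetaTransforms.T : OddThetaTransforms ModularGroup.T := by
  have hd : ∀ τ : ℍ, autDenom ModularGroup.T τ = 1 := fun τ => by simp [autDenom, ModularGroup.T]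
  have hc : ModularGroup.T 1 0 = 0 := by simp [ModularGroup.T]
  refine ⟨fun τ => Complex.exp (Real.pi * Complex.I / 4), continuous_const, fun τ => ?_,
    fun z τ => ?_⟩
  · rw [hd, ← Complex.exp_nat_mul, one_pow, Complex.exp_eq_one_iff]
    exact ⟨1, by push_cast; ring⟩
  · rw [hd, coe_sl_smul, hd, hc]
    have : ((ModularGroup.T 0 0 : ℤ) : ℂ) * (τ : ℂ) + ((ModularGroup.T 0 1 : ℤ) : ℂ) = τ + 1 := by
      simp [ModularGroup.T]
    rw [this, div_one, div_one, oddTheta_add_one_right]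
    simp

/-- The transformation law of the odd theta function under `SL₂(ℤ)`. -/
theorem oddThetaTransforms (γ : SL(2, ℤ)) : OddThetaTransforms γ := by
  have h : γ ∈ Subgroup.closure {ModularGroup.S, ModularGroup.T} := by
    simp [SpecialLinearGroup.SL2Z_generators]
  induction h using Subgroup.closure_induction with
  | one => exact .one
  | mem g hg =>
    rcases hg with rfl | rfl
    · exact .S
    · exact .T
  | mul g h _ _ ig ih => exact ig.mul ih
  | inv g _ ig => exact ig.inv

/-! ### The eta function -/

lemma continuous_eta_coe : Continuous fun τ : ℍ => ModularForm.eta (τ : ℂ) :=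
  continuous_iff_continuousAt.2 fun τ =>
    (ModularForm.differentiableAt_eta_of_mem_upperHalfPlaneSet τ.im_pos).continuousAt.comp
      UpperHalfPlane.continuous_coe.continuousAt

/-- The 24th power of eta is the discriminant, which is invariant of weight 12. -/
lemma eta_pow_smul (γ : SL(2, ℤ)) (τ : ℍ) :
    ModularForm.eta ((γ • τ : ℍ) : ℂ) ^ 24 = autDenom γ τ ^ 12 * ModularForm.eta (τ : ℂ) ^ 24 := by
  have h := congrFun (SlashInvariantForm.slash_action_generators_SL2Z ModularForm.discriminant_S_invariant
    ModularForm.discriminant_T_invariant γ) τ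
  rw [ModularForm.SL_slash_apply, ModularGroup.denom_apply, ← autDenom] at h
  have h0 := autDenom_ne_zero γ τ
  rw [zpow_neg, ← div_eq_mul_inv, div_eq_iff (zpow_ne_zero _ h0)] at h
  rw [mul_comm]
  exact_mod_cast h

/-- The eta function is modular of weight `1/2` up to a 24th root of unity. -/
lemma exists_eta_smul (γ : SL(2, ℤ)) : ∃ K : ℍ → ℂ, Continuous K ∧
    (∀ τ, K τ ^ 24 = autDenom γ τ ^ 12) ∧
    ∀ τ : ℍ, ModularForm.eta ((γ • τ : ℍ) : ℂ) = K τ * ModularForm.eta (τ : ℂ) := by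
  have h0 : ∀ τ : ℍ, ModularForm.eta (τ : ℂ) ≠ 0 := fun τ => ModularForm.eta_ne_zero τ.im_pos
  refine ⟨fun τ => ModularForm.eta ((γ • τ : ℍ) : ℂ) / ModularForm.eta (τ : ℂ),
    (continuous_eta_coe.comp (continuous_sl_smul γ)).div continuous_eta_coe h0,
    fun τ => ?_, fun τ => (div_mul_cancel₀ _ (h0 τ)).symm⟩
  rw [div_pow, eta_pow_smul, mul_div_cancel_right₀ _ (pow_ne_zero _ (h0 τ))]

/-! ### The even part of `g2` as an eta-theta quotient -/

lemma eta_eq_qInf (τ : ℂ) : ModularForm.eta τ = Complex.exp (2 * Real.pi * Complex.I * τ / 24) *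
    qInf (Complex.exp (2 * Real.pi * Complex.I * τ)) (Complex.exp (2 * Real.pi * Complex.I * τ)) := by
  have h : ∀ n, 1 - ModularForm.eta_q n τ = 1 - Complex.exp (2 * Real.pi * Complex.I * τ) *
      Complex.exp (2 * Real.pi * Complex.I * τ) ^ n := fun n => by
    rw [ModularForm.eta_q_eq_pow, pow_succ']
  rw [ModularForm.eta, qInf, tprod_congr h, Function.Periodic.qParam]
  norm_num

lemma qInf_neg_mul_qInf {q : ℂ} (hq : ‖q‖ < 1) :
    qInf (-q) q * qInf q q = qInf (q ^ 2) (q ^ 2) := by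
  rw [qInf, qInf, ← (multipliable_one_sub_mul_pow hq _).tprod_mul (multipliable_one_sub_mul_pow hq _)]
  refine tprod_congr fun j => ?_
  rw [← pow_mul]
  ring

/-- The weight one eta quotient `2 η(2τ)⁴ / η(τ)²`. -/
noncomputable def etaQuot (τ : ℂ) : ℂ := 2 * ModularForm.eta (2 * τ) ^ 4 / ModularForm.eta τ ^ 2

lemma im_two_mul_pos {τ : ℂ} (hτ : 0 < τ.im) : 0 < (2 * τ).im := by simpa using hτ

lemma etaQuot_ne_zero {τ : ℂ} (hτ : 0 < τ.im) : etaQuot τ ≠ 0 :=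
  div_ne_zero (mul_ne_zero two_ne_zero (pow_ne_zero _ (ModularForm.eta_ne_zero (im_two_mul_pos hτ))))
    (pow_ne_zero _ (ModularForm.eta_ne_zero hτ))

/-- The infinite products match by `g2_add_g2_neg`, the triple product and `(-q; q)_∞ (q; q)_∞ =
(q²; q²)_∞`. In powers of `q^{1/24}`, the eta quotient contributes `8 - 2` and theta contributes
`6`, which cancel; the factor `x^{-1/2} = w^{-1}` of theta accounts for the prefactor `w`. -/
theorem g2_even_part {α τ : ℂ} (hτ : 0 < τ.im) (h : ∀ n m : ℤ, 2 * α ≠ 2 * n * τ + m) :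
    Summable (g2Term (Complex.exp (2 * Real.pi * Complex.I * α))
      (Complex.exp (2 * Real.pi * Complex.I * τ))) ∧
    Summable (g2Term (-Complex.exp (2 * Real.pi * Complex.I * α))
      (Complex.exp (2 * Real.pi * Complex.I * τ))) ∧
    oddTheta (2 * α) (2 * τ) ≠ 0 ∧
    g2Sum (α, τ) = etaQuot τ / oddTheta (2 * α) (2 * τ) := by
  have hτ2 := im_two_mul_pos hτ
  have h' : ∀ n m : ℤ, 2 * α ≠ n * (2 * τ) + m := fun n m e => h n m (by rw [e]; ring)
  have hθ := oddTheta_ne_zero hτ2 h'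
  have hpf := pairFactor_exp_ne_zero h'
  have hθe := oddTheta_eq_prod (2 * α) hτ2
  have hη := eta_eq_qInf τ
  have hη2 := eta_eq_qInf (2 * τ)
  have hq := norm_exp_two_pi_mul_I_mul_lt_one hτ
  have hw : Complex.exp (2 * Real.pi * Complex.I * α) ≠ 0 := Complex.exp_ne_zero _
  have ew : Complex.exp (2 * Real.pi * Complex.I * (2 * α)) =
      Complex.exp (2 * Real.pi * Complex.I * α) ^ 2 := by
    rw [← Complex.exp_nat_mul]; congr 1; push_cast; ring
  have eq2 : Complex.exp (2 * Real.pi * Complex.I * (2 * τ)) =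
      Complex.exp (2 * Real.pi * Complex.I * τ) ^ 2 := by
    rw [← Complex.exp_nat_mul]; congr 1; push_cast; ring
  have e1 : Complex.exp (2 * Real.pi * Complex.I * (2 * τ) / 24) =
      Complex.exp (2 * Real.pi * Complex.I * τ / 24) ^ 2 := by
    rw [← Complex.exp_nat_mul]; congr 1; push_cast; ring
  have e2 : Complex.exp (Real.pi * Complex.I * (2 * τ / 4 - 2 * α)) =
      Complex.exp (2 * Real.pi * Complex.I * τ / 24) ^ 6 /
        Complex.exp (2 * Real.pi * Complex.I * α) := by
    rw [← Complex.exp_nat_mul, ← Complex.exp_sub]; congr 1; push_cast; ring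
  rw [ew, eq2, e2] at hθe
  rw [e1, eq2] at hη2
  simp only [ew, eq2] at hpf
  obtain ⟨s1, s2, hs⟩ := g2_add_g2_neg hq hw hpf
  refine ⟨s1, s2, hθ, ?_⟩
  rw [g2Sum, hs, etaQuot, hη, hη2, hθe]
  have hE : Complex.exp (2 * Real.pi * Complex.I * τ / 24) ≠ 0 := Complex.exp_ne_zero _
  generalize Complex.exp (2 * Real.pi * Complex.I * τ / 24) = E at *
  generalize Complex.exp (2 * Real.pi * Complex.I * τ) = q at *
  generalize Complex.exp (2 * Real.pi * Complex.I * α) = w at *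
  have hq2 : ‖q ^ 2‖ < 1 := by
    rw [norm_pow]; exact pow_lt_one₀ (norm_nonneg q) hq two_ne_zero
  obtain ⟨n1, n2⟩ := qInf_ne_zero_of_pairFactor hq2 hpf
  have n3 := qInf_self_ne_zero hq
  have n4 := qInf_self_ne_zero hq2
  have hN := qInf_neg_mul_qInf hq
  rw [eq_div_of_mul_eq n3 hN]
  field_simp

/-- Stated with nonvanishing of theta because this condition is carried along by the transformation
laws. -/
lemma g2Sum_eq {α τ : ℂ} (hτ : 0 < τ.im) (h : oddTheta (2 * α) (2 * τ) ≠ 0) :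
    g2Sum (α, τ) = etaQuot τ / oddTheta (2 * α) (2 * τ) := by
  refine (g2_even_part hτ fun n m e => h ?_).2.2.2
  rw [e, show 2 * n * τ = n * (2 * τ) by ring]
  exact oddTheta_lattice n m _

/-! ### Analyticity and poles -/

lemma differentiableAt_etaQuot {τ : ℂ} (hτ : 0 < τ.im) : DifferentiableAt ℂ etaQuot τ := by
  have h1 := ModularForm.differentiableAt_eta_of_mem_upperHalfPlaneSet hτ
  have h2 : DifferentiableAt ℂ (fun t : ℂ => ModularForm.eta (2 * t)) τ :=
    (ModularForm.differentiableAt_eta_of_mem_upperHalfPlaneSet (im_two_mul_pos hτ)).comp τ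
      (by fun_prop)
  exact ((h2.pow 4).const_mul 2).div (h1.pow 2) (pow_ne_zero _ (ModularForm.eta_ne_zero hτ))

lemma eventually_im_pos {τ : ℂ} (hτ : 0 < τ.im) : ∀ᶠ t in 𝓝 τ, 0 < t.im :=
  Complex.continuous_im.continuousAt.eventually (lt_mem_nhds hτ)

lemma analyticAt_etaQuot {τ : ℂ} (hτ : 0 < τ.im) : AnalyticAt ℂ etaQuot τ := by
  have ho : IsOpen {t : ℂ | 0 < t.im} := isOpen_lt continuous_const Complex.continuous_im
  exact DifferentiableOn.analyticAt (s := {t : ℂ | 0 < t.im})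
    (fun t ht => (differentiableAt_etaQuot ht).differentiableWithinAt) (ho.mem_nhds hτ)

lemma analyticAt_oddTheta_two_mul (z : ℂ) {τ : ℂ} (hτ : 0 < τ.im) :
    AnalyticAt ℂ (fun p : ℂ × ℂ => oddTheta (2 * p.1) (2 * p.2)) (z, τ) := by
  have h1 : AnalyticAt ℂ (fun p : ℂ × ℂ => p.1) (z, τ) := analyticAt_fst
  have h2 : AnalyticAt ℂ (fun p : ℂ × ℂ => p.2) (z, τ) := analyticAt_snd
  exact (analyticAt_oddTheta (2 * z) (im_two_mul_pos hτ)).comp_of_eq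
    (f := fun p : ℂ × ℂ => (2 * p.1, 2 * p.2))
    ((analyticAt_const.mul h1).prod (analyticAt_const.mul h2)) rfl

/-- Near a zero, a real displacement `0 < ε < 1/2` moves `2z` by `2ε ∈ (0, 1)`, which is not a
difference of two lattice points. -/
lemma frequently_oddTheta_two_mul_ne_zero (z : ℂ) {τ : ℂ} (hτ : 0 < τ.im) :
    ∃ᶠ x in 𝓝 z, oddTheta (2 * x) (2 * τ) ≠ 0 := by
  by_cases h : oddTheta (2 * z) (2 * τ) = 0
  · obtain ⟨n, m, hnm⟩ := (oddTheta_eq_zero_iff (im_two_mul_pos hτ)).1 h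
    have ht : Tendsto (fun ε : ℝ => z + ε) (𝓝[>] 0) (𝓝 z) := by
      have : Tendsto (fun ε : ℝ => z + (ε : ℂ)) (𝓝 0) (𝓝 (z + ((0 : ℝ) : ℂ))) :=
        (continuous_const.add Complex.continuous_ofReal).tendsto 0
      rw [Complex.ofReal_zero, add_zero] at this
      exact this.mono_left nhdsWithin_le_nhds
    refine ht.frequently (Eventually.frequently ?_)
    filter_upwards [Ioo_mem_nhdsGT (by norm_num : (0 : ℝ) < 1 / 2)] with ε hε h0
    obtain ⟨n', m', hnm'⟩ := (oddTheta_eq_zero_iff (im_two_mul_pos hτ)).1 h0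
    have e : (2 * ε : ℂ) = ((n' - n : ℤ) : ℂ) * (2 * τ) + ((m' - m : ℤ) : ℂ) := by
      push_cast; linear_combination hnm' - hnm
    have e1 := congrArg Complex.im e
    have e2 := congrArg Complex.re e
    simp only [Complex.add_im, Complex.mul_im, Complex.add_re, Complex.mul_re, Complex.re_ofNat,
      Complex.im_ofNat, Complex.ofReal_re, Complex.ofReal_im, Complex.intCast_re,
      Complex.intCast_im] at e1 e2
    have e3 : ((n' - n : ℤ) : ℝ) = 0 := by
      have : ((n' - n : ℤ) : ℝ) * (2 * τ.im) = 0 := by linarith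
      exact (mul_eq_zero.1 this).resolve_right (by positivity)
    rw [e3] at e2
    have l1 : (0 : ℝ) < ((m' - m : ℤ) : ℝ) := by linarith [hε.1]
    have l2 : ((m' - m : ℤ) : ℝ) < 1 := by linarith [hε.2]
    have l3 : 0 < m' - m := by exact_mod_cast l1
    have l4 : m' - m < 1 := by exact_mod_cast l2
    omega
  · have hc : ContinuousAt (fun x => oddTheta (2 * x) (2 * τ)) z :=
      (analyticAt_oddTheta_two_mul z hτ).continuousAt.comp (f := fun x : ℂ => (x, τ)) (by fun_prop)
    exact (hc.eventually_ne h).frequently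

/-- At a zero of theta the product `g2Sum * ϑ` would be continuous with value 0, yet it equals the
nonzero `etaQuot τ` at points arbitrarily near. Thus the value assigned to `g2Sum` at a pole cannot
make it holomorphic there. -/
lemma oddTheta_ne_zero_of_analyticAt {z τ : ℂ} (hτ : 0 < τ.im) (h : AnalyticAt ℂ g2Sum (z, τ)) :
    oddTheta (2 * z) (2 * τ) ≠ 0 := by
  intro h0
  have c1 : ContinuousAt (fun x => g2Sum (x, τ)) z :=
    h.continuousAt.comp (f := fun x : ℂ => (x, τ)) (by fun_prop)
  have c2 : ContinuousAt (fun x => oddTheta (2 * x) (2 * τ)) z :=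
    (analyticAt_oddTheta_two_mul z hτ).continuousAt.comp (f := fun x : ℂ => (x, τ)) (by fun_prop)
  have c3 := c1.mul c2
  have hE := etaQuot_ne_zero hτ
  have hne : ∀ᶠ x in 𝓝 z, g2Sum (x, τ) * oddTheta (2 * x) (2 * τ) ≠ etaQuot τ := by
    refine c3.eventually_ne ?_
    change g2Sum (z, τ) * oddTheta (2 * z) (2 * τ) ≠ etaQuot τ
    rw [h0, mul_zero]
    exact hE.symm
  obtain ⟨x, hx1, hx2⟩ := ((frequently_oddTheta_two_mul_ne_zero z hτ).and_eventually hne).exists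
  exact hx2 (by rw [g2Sum_eq hτ hx1, div_mul_cancel₀ _ hx1])

theorem meromorphicNear_g2Sum (z : ℂ) {τ : ℂ} (hτ : 0 < τ.im) : MeromorphicNear g2Sum (z, τ) := by
  refine ⟨fun p => etaQuot p.2, fun p => oddTheta (2 * p.1) (2 * p.2),
    (analyticAt_etaQuot hτ).comp_of_eq analyticAt_snd rfl, analyticAt_oddTheta_two_mul z hτ, ?_, ?_⟩
  · have ht : Tendsto (fun x : ℂ => (x, τ)) (𝓝 z) (𝓝 (z, τ)) :=
      (by fun_prop : Continuous fun x : ℂ => (x, τ)).tendsto z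
    exact ht.frequently (frequently_oddTheta_two_mul_ne_zero z hτ)
  · filter_upwards [continuous_snd.continuousAt.eventually (eventually_im_pos hτ)] with p hp h
    exact g2Sum_eq hp h

/-! ### Doubling the modular variable -/

/-- The element of `SL₂(ℤ)` with given entries. -/
def slOf (a b c d : ℤ) (h : a * d - b * c = 1) : SL(2, ℤ) :=
  ⟨!![a, b; c, d], by rw [Matrix.det_fin_two_of]; exact h⟩

section

variable (a b c d : ℤ) (h : a * d - b * c = 1)

lemma slOf_zero_zero : slOf a b c d h 0 0 = a := rfl

lemma slOf_zero_one : slOf a b c d h 0 1 = b := rfl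

lemma slOf_one_zero : slOf a b c d h 1 0 = c := rfl

lemma slOf_one_one : slOf a b c d h 1 1 = d := rfl

end

/-- A factorization `2 (γ τ) = γ' (A τ + B)` with `γ'` in `SL₂(ℤ)`, where the automorphy denominator
of `γ'` is `κ` times that of `γ`. -/
structure Doubling (γ : SL(2, ℤ)) where
  mat : SL(2, ℤ)
  κ : ℝ
  A : ℝ
  B : ℝ
  σ : ℍ → ℍ
  κ_pos : 0 < κ
  A_pos : 0 < A
  coe_σ : ∀ τ, ((σ τ : ℍ) : ℂ) = A * (τ : ℂ) + B
  coe_smul : ∀ τ, ((mat • σ τ : ℍ) : ℂ) = 2 * ((γ • τ : ℍ) : ℂ)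
  autDenom_eq : ∀ τ, autDenom mat (σ τ) = κ * autDenom γ τ
  lower_left : 2 * (κ : ℂ) * ((mat 1 0 : ℤ) : ℂ) = ((γ 1 0 : ℤ) : ℂ)

/-- The affine map `τ ↦ A τ + B` of the upper half plane. -/
def affineUHP (A B : ℝ) (hA : 0 < A) (τ : ℍ) : ℍ :=
  ⟨A * (τ : ℂ) + B, by simpa using mul_pos hA τ.im_pos⟩

lemma coe_affineUHP (A B : ℝ) (hA : 0 < A) (τ : ℍ) :
    ((affineUHP A B hA τ : ℍ) : ℂ) = A * (τ : ℂ) + B := rfl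

/-- The doubling of a matrix with even lower left entry. -/
def Doubling.ofEven (γ : SL(2, ℤ)) (c : ℤ) (hc : γ 1 0 = 2 * c) : Doubling γ where
  -- From `diag(2, 1) γ = γ' diag(2, 1)`.
  mat := slOf (γ 0 0) (2 * γ 0 1) c (γ 1 1) (by linear_combination sl_det γ + γ 0 1 * hc)
  κ := 1
  A := 2
  B := 0
  σ := affineUHP 2 0 two_pos
  κ_pos := one_pos
  A_pos := two_pos
  coe_σ := fun τ => rfl
  coe_smul := fun τ => by
    have hc' : ((γ 1 0 : ℤ) : ℂ) = 2 * c := by exact_mod_cast hc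
    have e : (c : ℂ) * (2 * τ) + ((γ 1 1 : ℤ) : ℂ) = autDenom γ τ := by
      rw [autDenom, hc']; ring
    rw [coe_sl_smul, coe_sl_smul, autDenom, coe_affineUHP]
    simp only [slOf_zero_zero, slOf_zero_one, slOf_one_zero, slOf_one_one]
    push_cast
    rw [add_zero, e]
    ring
  autDenom_eq := fun τ => by
    have hc' : ((γ 1 0 : ℤ) : ℂ) = 2 * c := by exact_mod_cast hc
    rw [autDenom, autDenom, coe_affineUHP, slOf_one_zero, slOf_one_one, hc']
    push_cast
    ring
  lower_left := by
    have hc' : ((γ 1 0 : ℤ) : ℂ) = 2 * c := by exact_mod_cast hc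
    rw [slOf_one_zero, hc']
    push_cast
    ring

/-- The doubling of a matrix with odd lower left entry. -/
noncomputable def Doubling.ofOdd (γ : SL(2, ℤ)) (k : ℤ) (hk : γ 1 0 = 2 * k + 1) : Doubling γ where
  -- From `diag(2, 1) γ = γ' (1, d; 0, 2)`, so that `σ τ = (τ + d)/2`; the lower right entry works
  -- because `c d - 2 k d = d`.
  mat := slOf (2 * γ 0 0) (γ 0 1 - γ 0 0 * γ 1 1) (γ 1 0) (-k * γ 1 1)
    (by linear_combination sl_det γ + γ 0 0 * γ 1 1 * hk)
  κ := 1 / 2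
  A := 1 / 2
  B := (γ 1 1 : ℤ) / 2
  σ := affineUHP (1 / 2) ((γ 1 1 : ℤ) / 2) (by norm_num)
  κ_pos := by norm_num
  A_pos := by norm_num
  coe_σ := fun τ => rfl
  coe_smul := fun τ => by
    have hk' : ((γ 1 0 : ℤ) : ℂ) = 2 * k + 1 := by exact_mod_cast hk
    have h0 := autDenom_ne_zero γ τ
    have e : ((γ 1 0 : ℤ) : ℂ) * (1 / 2 * (τ : ℂ) + ((γ 1 1 : ℤ) : ℂ) / 2) +
        -(k : ℂ) * ((γ 1 1 : ℤ) : ℂ) = autDenom γ τ / 2 := by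
      rw [autDenom, hk']; ring
    rw [coe_sl_smul, coe_sl_smul, autDenom, coe_affineUHP]
    simp only [slOf_zero_zero, slOf_zero_one, slOf_one_zero, slOf_one_one]
    push_cast
    rw [e]
    field_simp
    ring
  autDenom_eq := fun τ => by
    have hk' : ((γ 1 0 : ℤ) : ℂ) = 2 * k + 1 := by exact_mod_cast hk
    rw [autDenom, autDenom, coe_affineUHP, slOf_one_zero, slOf_one_one, hk']
    push_cast
    ring
  lower_left := by
    rw [slOf_one_zero]
    push_cast
    ring

lemma nonempty_doubling (γ : SL(2, ℤ)) : Nonempty (Doubling γ) := by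
  rcases Int.even_or_odd' (γ 1 0) with ⟨k, hk | hk⟩
  · exact ⟨.ofEven γ k hk⟩
  · exact ⟨.ofOdd γ k hk⟩

lemma Doubling.continuous_σ {γ : SL(2, ℤ)} (D : Doubling γ) : Continuous D.σ := by
  refine UpperHalfPlane.isOpenEmbedding_coe.isEmbedding.continuous_iff.2 ?_
  simp only [Function.comp_def, D.coe_σ]
  exact (continuous_const.mul UpperHalfPlane.continuous_coe).add continuous_const

/-- Transformation of `oddTheta (2 z) (2 τ)`. -/
lemma Doubling.exists_oddTheta {γ : SL(2, ℤ)} (D : Doubling γ) : ∃ J : ℍ → ℂ, Continuous J ∧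
    (∀ τ, J τ ^ 8 = (D.κ * autDenom γ τ) ^ 4) ∧ ∀ (z : ℂ) (τ : ℍ),
      oddTheta (2 * (z / autDenom γ τ)) (2 * ((γ • τ : ℍ) : ℂ)) =
        J τ * Complex.exp (2 * Real.pi * Complex.I * ((γ 1 0 : ℤ) : ℂ) * z ^ 2 / autDenom γ τ) *
          oddTheta (2 * D.κ * z) ((D.σ τ : ℍ) : ℂ) := by
  obtain ⟨J, hJ, hJ8, h⟩ := oddThetaTransforms D.mat
  refine ⟨fun τ => J (D.σ τ), hJ.comp D.continuous_σ, fun τ => by rw [hJ8, D.autDenom_eq],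
    fun z τ => ?_⟩
  have hκ : (D.κ : ℂ) ≠ 0 := by exact_mod_cast D.κ_pos.ne'
  have h0 := autDenom_ne_zero γ τ
  have hz := h (2 * D.κ * z) (D.σ τ)
  rw [D.autDenom_eq, D.coe_smul, show 2 * (D.κ : ℂ) * z / (D.κ * autDenom γ τ) =
    2 * (z / autDenom γ τ) by field_simp, show Real.pi * Complex.I * ((D.mat 1 0 : ℤ) : ℂ) *
      (2 * D.κ * z) ^ 2 / (D.κ * autDenom γ τ) =
      2 * Real.pi * Complex.I * ((γ 1 0 : ℤ) : ℂ) * z ^ 2 / autDenom γ τ by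
        rw [← D.lower_left]; field_simp] at hz
  exact hz

lemma etaQuot_smul_eq {γ : SL(2, ℤ)} (D : Doubling γ) : ∃ K L : ℍ → ℂ, Continuous K ∧
    Continuous L ∧ (∀ τ, K τ ^ 24 = (D.κ * autDenom γ τ) ^ 12) ∧
    (∀ τ, L τ ^ 24 = autDenom γ τ ^ 12) ∧ ∀ τ : ℍ, etaQuot ((γ • τ : ℍ) : ℂ) =
      K τ ^ 4 / L τ ^ 2 * (2 * ModularForm.eta ((D.σ τ : ℍ) : ℂ) ^ 4 /
        ModularForm.eta (τ : ℂ) ^ 2) := by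
  obtain ⟨K, hK, hK24, hKη⟩ := exists_eta_smul D.mat
  obtain ⟨L, hL, hL24, hLη⟩ := exists_eta_smul γ
  refine ⟨fun τ => K (D.σ τ), L, hK.comp D.continuous_σ, hL, fun τ => by rw [hK24, D.autDenom_eq],
    hL24, fun τ => ?_⟩
  rw [etaQuot, ← D.coe_smul, hKη, hLη, mul_pow, mul_pow, mul_left_comm, mul_div_mul_comm]

/-! ### Transformation laws of `g2Sum` -/

/-- Here `2α` moves by `l (2τ) + 2n`; the even integer `2n` contributes no sign, so the character is
`(-1)^l` alone. -/
theorem g2Sum_elliptic (l n : ℤ) (z : ℂ) {τ : ℂ} (hτ : 0 < τ.im)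
    (h : oddTheta (2 * z) (2 * τ) ≠ 0) : g2Sum (z + l * τ + n, τ) =
      (-1) ^ l * Complex.exp (2 * Real.pi * Complex.I * (l ^ 2 * τ + 2 * l * z)) * g2Sum (z, τ) := by
  have e := oddTheta_add_lattice l (2 * n) (2 * z) (2 * τ)
  rw [show 2 * z + l * (2 * τ) + ((2 * n : ℤ) : ℂ) = 2 * (z + l * τ + n) by push_cast; ring,
    zpow_add₀ (by norm_num), zpow_mul, show ((-1 : ℂ) ^ (2 : ℤ)) = 1 by norm_num, one_zpow,
    mul_one] at e
  have h2 : (-1 : ℂ) ^ l * (-1) ^ l = 1 := by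
    rw [← mul_zpow]; norm_num
  have h3 : (-1 : ℂ) ^ l ≠ 0 := left_ne_zero_of_mul_eq_one h2
  have h1 : oddTheta (2 * (z + l * τ + n)) (2 * τ) ≠ 0 := by
    rw [e]
    exact mul_ne_zero (mul_ne_zero h3 (Complex.exp_ne_zero _)) h
  rw [g2Sum_eq hτ h1, g2Sum_eq hτ h, e, Complex.exp_neg,
    show Real.pi * Complex.I * (l ^ 2 * (2 * τ) + 2 * l * (2 * z)) =
      2 * Real.pi * Complex.I * (l ^ 2 * τ + 2 * l * z) by ring]
  have h4 := Complex.exp_ne_zero (2 * Real.pi * Complex.I * (l ^ 2 * τ + 2 * l * z))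
  field_simp
  rw [sq, h2, mul_one]

/-- For `c ≠ 0` the number `cτ + d` is never real and so avoids the branch cut; for `c = 0` it is
constant. -/
lemma continuous_autDenom_cpow (γ : SL(2, ℤ)) (s : ℂ) : Continuous fun τ => autDenom γ τ ^ s := by
  by_cases hc : γ 1 0 = 0
  · have : (fun τ => autDenom γ τ ^ s) = fun _ => ((γ 1 1 : ℤ) : ℂ) ^ s := by
      funext τ
      rw [autDenom, hc]
      simp
    rw [this]
    exact continuous_const
  · refine (continuous_autDenom γ).cpow continuous_const fun τ => Or.inr ?_
    rw [autDenom]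
    simpa [τ.im_pos.ne'] using hc

/-- A continuous map from a connected space to a finite, hence discrete, set is constant. -/
lemma eq_const_of_pow_eq_one {f : ℍ → ℂ} (hf : Continuous f) {n : ℕ} (hn : 0 < n)
    (h : ∀ τ, f τ ^ n = 1) : ∃ v : ℂ, v ^ n = 1 ∧ ∀ τ, f τ = v := by
  have hfin : {x : ℂ | x ^ n = 1}.Finite := by
    refine (Polynomial.nthRootsFinset n (1 : ℂ)).finite_toSet.subset fun x hx => ?_
    exact (Polynomial.mem_nthRootsFinset hn (1 : ℂ)).2 hx
  have := hfin.instDiscreteTopology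
  refine ⟨f UpperHalfPlane.I, h _, fun τ => ?_⟩
  exact isPreconnected_univ.constant_of_mapsTo (T := {x : ℂ | x ^ n = 1}) this.isDiscrete
    hf.continuousOn (fun τ _ => h τ) (Set.mem_univ _) (Set.mem_univ _)

lemma ne_zero_of_pow_eq {x y : ℂ} {m n : ℕ} (h : x ^ m = y ^ n) (hm : m ≠ 0) (hy : y ≠ 0) :
    x ≠ 0 := by
  rintro rfl
  rw [zero_pow hm] at h
  exact pow_ne_zero n hy h.symm

/-- The value of `g2Sum` at a transformed point. -/
lemma exists_g2Sum_smul {γ : SL(2, ℤ)} (D : Doubling γ) : ∃ K L J : ℍ → ℂ,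
    (Continuous K ∧ Continuous L ∧ Continuous J) ∧
    (∀ τ, K τ ^ 24 = (D.κ * autDenom γ τ) ^ 12) ∧ (∀ τ, L τ ^ 24 = autDenom γ τ ^ 12) ∧
    (∀ τ, J τ ^ 8 = (D.κ * autDenom γ τ) ^ 4) ∧ ∀ (z : ℂ) (τ : ℍ),
      oddTheta (2 * (z / autDenom γ τ)) (2 * ((γ • τ : ℍ) : ℂ)) ≠ 0 →
      oddTheta (2 * D.κ * z) ((D.σ τ : ℍ) : ℂ) ≠ 0 ∧
      g2Sum (z / autDenom γ τ, ((γ • τ : ℍ) : ℂ)) = K τ ^ 4 / (L τ ^ 2 * J τ) *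
        Complex.exp (-(2 * Real.pi * Complex.I * ((γ 1 0 : ℤ) : ℂ) * z ^ 2 / autDenom γ τ)) *
        (2 * ModularForm.eta ((D.σ τ : ℍ) : ℂ) ^ 4 /
          (ModularForm.eta (τ : ℂ) ^ 2 * oddTheta (2 * D.κ * z) ((D.σ τ : ℍ) : ℂ))) := by
  obtain ⟨K, L, hK, hL, hK24, hL24, hE⟩ := etaQuot_smul_eq D
  obtain ⟨J, hJ, hJ8, hθ⟩ := D.exists_oddTheta
  refine ⟨K, L, J, ⟨hK, hL, hJ⟩, hK24, hL24, hJ8, fun z τ h => ⟨?_, ?_⟩⟩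
  · rw [hθ] at h
    exact right_ne_zero_of_mul h
  · rw [g2Sum_eq (γ • τ).im_pos h, hE, hθ, Complex.exp_neg]
    simp only [div_eq_mul_inv, mul_inv]
    ring

theorem g2Sum_modular {γ : SL(2, ℤ)} (hγ : γ ∈ CongruenceSubgroup.Gamma0 2) :
    ∃ v : ℂ, v ^ 24 = 1 ∧ ∀ (z : ℂ) (τ : ℍ), oddTheta (2 * z) (2 * (τ : ℂ)) ≠ 0 →
      oddTheta (2 * (z / autDenom γ τ)) (2 * ((γ • τ : ℍ) : ℂ)) ≠ 0 →
      g2Sum (z / autDenom γ τ, ((γ • τ : ℍ) : ℂ)) = v * autDenom γ τ ^ (1 / 2 : ℂ) *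
        Complex.exp (-(2 * Real.pi * Complex.I * ((γ 1 0 : ℤ) : ℂ) * z ^ 2 / autDenom γ τ)) *
        g2Sum (z, (τ : ℂ)) := by
  rw [CongruenceSubgroup.Gamma0_mem, ZMod.intCast_zmod_eq_zero_iff_dvd] at hγ
  obtain ⟨c, hc⟩ := hγ
  obtain ⟨K, L, J, ⟨hK, hL, hJ⟩, hK24, hL24, hJ8, h⟩ := exists_g2Sum_smul (Doubling.ofEven γ c hc)
  have hκ : ((Doubling.ofEven γ c hc).κ : ℂ) = 1 := Complex.ofReal_one
  have hσ : ∀ τ : ℍ, (((Doubling.ofEven γ c hc).σ τ : ℍ) : ℂ) = 2 * τ := fun τ => by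
    rw [(Doubling.ofEven γ c hc).coe_σ]
    simp [Doubling.ofEven]
  simp only [hκ, one_mul, mul_one, hσ] at hK24 hJ8 h
  have hd := autDenom_ne_zero γ
  have hL0 : ∀ τ, L τ ≠ 0 := fun τ => ne_zero_of_pow_eq (hL24 τ) (by norm_num) (hd τ)
  have hJ0 : ∀ τ, J τ ≠ 0 := fun τ => ne_zero_of_pow_eq (hJ8 τ) (by norm_num) (hd τ)
  have hs0 : ∀ τ, autDenom γ τ ^ (1 / 2 : ℂ) ≠ 0 := fun τ => by
    rw [Ne, Complex.cpow_eq_zero_iff]; simp [hd τ]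
  have hs : ∀ τ, (autDenom γ τ ^ (1 / 2 : ℂ)) ^ 24 = autDenom γ τ ^ 12 := fun τ => by
    rw [← Complex.cpow_nat_mul, show ((24 : ℕ) : ℂ) * (1 / 2) = (12 : ℕ) by norm_num,
      Complex.cpow_natCast]
  -- In the 24th power, `K^4` gives `(cτ + d)^48`, while `L^2`, `J` and the square root give
  -- exponents `24`, `12` and `12`; these cancel.
  obtain ⟨v, hv, hv'⟩ := eq_const_of_pow_eq_one (n := 24)
    (f := fun τ => K τ ^ 4 / (L τ ^ 2 * J τ) / autDenom γ τ ^ (1 / 2 : ℂ))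
    (((hK.pow 4).div ((hL.pow 2).mul hJ) fun τ => mul_ne_zero (pow_ne_zero _ (hL0 τ)) (hJ0 τ)).div
      (continuous_autDenom_cpow γ _) hs0) (by norm_num) fun τ => by
        rw [div_pow, div_pow, mul_pow, hs, show (K τ ^ 4) ^ 24 = (K τ ^ 24) ^ 4 by ring,
          show (L τ ^ 2) ^ 24 = (L τ ^ 24) ^ 2 by ring, show J τ ^ 24 = (J τ ^ 8) ^ 3 by ring,
          hK24, hL24, hJ8]
        have := hd τ
        field_simp
  refine ⟨v, hv, fun z τ h1 h2 => ?_⟩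
  have h3 := (h z τ h2).2
  rw [h3, ← (div_eq_iff (hs0 τ)).1 (hv' τ), g2Sum_eq τ.im_pos h1, etaQuot]
  have := hs0 τ
  field_simp

/-! ### Growth -/

/-- The inequality `∏ (1 - x_j) ≥ 1 - ∑ x_j` for `x_j = |a| 2^{-j}`. -/
lemma one_sub_le_norm_qPoch {a q : ℂ} (hq : ‖q‖ ≤ 1 / 2) (ha : ‖a‖ ≤ 1 / 4) (n : ℕ) :
    1 - 2 * ‖a‖ * (1 - (1 / 2) ^ n) ≤ ‖qPoch a q n‖ := by
  induction n with
  | zero => simp [qPoch_zero]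
  | succ n ih =>
    have h1 : ‖a * q ^ n‖ ≤ ‖a‖ * (1 / 2) ^ n := by
      rw [norm_mul, norm_pow]
      gcongr
    have h2 : 1 - ‖a‖ * (1 / 2) ^ n ≤ ‖1 - a * q ^ n‖ := by
      have := norm_sub_norm_le 1 (a * q ^ n)
      rw [norm_one] at this
      linarith
    have h3 : (1 / 2 : ℝ) ^ n ≤ 1 := pow_le_one₀ (by norm_num) (by norm_num)
    have h4 : (0 : ℝ) < (1 / 2) ^ n := by positivity
    have h5 := norm_nonneg a
    rw [qPoch_succ, norm_mul]
    calc _ ≤ (1 - 2 * ‖a‖ * (1 - (1 / 2) ^ n)) * (1 - ‖a‖ * (1 / 2) ^ n) := by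
          rw [pow_succ]
          nlinarith [mul_nonneg (mul_nonneg h5 (sub_nonneg.2 h3)) (mul_nonneg h5 h4.le)]
      _ ≤ _ := mul_le_mul ih h2 (by nlinarith) (norm_nonneg _)

lemma half_le_norm_qInf {a q : ℂ} (hq : ‖q‖ ≤ 1 / 2) (ha : ‖a‖ ≤ 1 / 4) :
    1 / 2 ≤ ‖qInf a q‖ := by
  refine ge_of_tendsto' (tendsto_qPoch (hq.trans_lt (by norm_num)) a).norm fun n => ?_
  have h := one_sub_le_norm_qPoch hq ha n
  have h4 : (0 : ℝ) < (1 / 2) ^ n := by positivity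
  nlinarith [norm_nonneg a]

lemma qInf_eq_mul {q : ℂ} (hq : ‖q‖ < 1) (a : ℂ) : qInf a q = (1 - a) * qInf (a * q) q := by
  have h1 := (tendsto_qPoch hq a).comp (tendsto_add_atTop_nat 1)
  have h2 := (tendsto_qPoch hq (a * q)).const_mul (1 - a)
  refine tendsto_nhds_unique h1 (h2.congr fun n => ?_)
  rw [Function.comp_apply, qPoch, qPoch, Finset.prod_range_succ', mul_comm]
  simp [pow_succ', mul_assoc]

lemma exp_neg_le_quarter {t : ℝ} (ht : 3 ≤ t) : Real.exp (-t) ≤ 1 / 4 := by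
  rw [Real.exp_neg, inv_le_comm₀ (Real.exp_pos t) (by norm_num)]
  have := Real.add_one_le_exp t
  norm_num
  linarith

lemma exp_neg_inv_le {δ : ℝ} (hδ : 0 < δ) : Real.exp (-δ⁻¹) ≤ δ := by
  rw [Real.exp_neg, inv_le_comm₀ (Real.exp_pos _) hδ]
  have := Real.add_one_le_exp δ⁻¹
  linarith

lemma norm_exp_two_pi_mul_I_mul (z : ℂ) :
    ‖Complex.exp (2 * Real.pi * Complex.I * z)‖ = Real.exp (-(2 * Real.pi * z.im)) := by
  rw [Complex.norm_exp]
  simp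

lemma norm_exp_pi_mul_I_mul (z : ℂ) :
    ‖Complex.exp (Real.pi * Complex.I * z)‖ = Real.exp (-(Real.pi * z.im)) := by
  rw [Complex.norm_exp]
  simp

/-- For `0 ≤ r < 1` one has `|x| ≤ 1`, and `q` and `q/x` are small high up, so only the factor `1 -
x` of the triple product is delicate. It is a nonzero constant if `r = 0` and stays away from 0 if
`r > 0`. -/
lemma oddTheta_lower_bound_of_mem_Ico {r : ℝ} (hr0 : 0 ≤ r) (hr1 : r < 1) (s : ℝ)
    (h : ¬ (r = 0 ∧ ∃ m : ℤ, s = m)) : ∃ C A : ℝ, ∀ τ : ℍ, A ≤ τ.im →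
      Real.exp (-(C * τ.im)) ≤ ‖oddTheta (r * (τ : ℂ) + s) τ‖ := by
  have hpi : (3 : ℝ) < Real.pi := Real.pi_gt_three
  obtain ⟨δ, hδ, A₀, hA₀⟩ : ∃ δ : ℝ, 0 < δ ∧ ∃ A : ℝ, ∀ τ : ℍ, A ≤ τ.im →
      δ ≤ ‖1 - Complex.exp (2 * Real.pi * Complex.I * (r * (τ : ℂ) + s))‖ := by
    rcases hr0.eq_or_lt with hr | hr
    · refine ⟨‖1 - Complex.exp (2 * Real.pi * Complex.I * s)‖, norm_pos_iff.2 fun e => ?_, 0,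
        fun τ _ => by rw [← hr]; simp⟩
      obtain ⟨n, hn⟩ := Complex.exp_eq_one_iff.1 (sub_eq_zero.1 e).symm
      refine h ⟨hr.symm, n, ?_⟩
      have : (s : ℂ) = n := mul_left_cancel₀ Complex.two_pi_I_ne_zero (by linear_combination hn)
      exact_mod_cast this
    · refine ⟨1 / 2, by norm_num, 1 / r, fun τ hτ => ?_⟩
      have h1 := norm_exp_two_pi_mul_I_mul (r * (τ : ℂ) + s)
      have h2 : 1 ≤ r * τ.im := by rwa [div_le_iff₀' hr] at hτ
      have h3 : Real.exp (-(2 * Real.pi * (r * (τ : ℂ) + s).im)) ≤ 1 / 4 := by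
        refine exp_neg_le_quarter ?_
        simp only [Complex.add_im, Complex.im_ofReal_mul, Complex.ofReal_im,
          add_zero, UpperHalfPlane.coe_im]
        nlinarith
      have h4 := norm_sub_norm_le 1 (Complex.exp (2 * Real.pi * Complex.I * (r * (τ : ℂ) + s)))
      rw [norm_one] at h4
      linarith
  -- The term `π` covers the exponential prefactor. The other factors have product at least `δ/8`,
  -- made exponential by `exp (-1/t) ≤ t`. The threshold `1/(1 - r)` forces `|q/x| ≤ 1/4`.
  refine ⟨Real.pi + (δ / 8)⁻¹, max (max A₀ 1) (1 / (1 - r)), fun τ hτ => ?_⟩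
  have y1 : 1 ≤ τ.im := (le_max_right _ _).trans ((le_max_left _ _).trans hτ)
  have y0 : A₀ ≤ τ.im := (le_max_left _ _).trans ((le_max_left _ _).trans hτ)
  have y2 : 1 ≤ (1 - r) * τ.im := by
    have := (le_max_right _ _).trans hτ
    rwa [div_le_iff₀' (sub_pos.2 hr1)] at this
  have hx := hA₀ τ y0
  have hq4 : ‖Complex.exp (2 * Real.pi * Complex.I * (τ : ℂ))‖ ≤ 1 / 4 := by
    rw [norm_exp_two_pi_mul_I_mul]
    refine exp_neg_le_quarter ?_
    rw [UpperHalfPlane.coe_im]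
    nlinarith
  have him : (r * (τ : ℂ) + s).im = r * τ.im := by simp
  have hx1 : ‖Complex.exp (2 * Real.pi * Complex.I * (r * (τ : ℂ) + s))‖ ≤ 1 := by
    rw [norm_exp_two_pi_mul_I_mul, him, Real.exp_le_one_iff]
    have := mul_nonneg hr0 τ.im_pos.le
    nlinarith
  have hqx : ‖Complex.exp (2 * Real.pi * Complex.I * (τ : ℂ)) /
      Complex.exp (2 * Real.pi * Complex.I * (r * (τ : ℂ) + s))‖ ≤ 1 / 4 := by
    rw [← Complex.exp_sub, ← mul_sub, norm_exp_two_pi_mul_I_mul]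
    refine exp_neg_le_quarter ?_
    rw [Complex.sub_im, him, UpperHalfPlane.coe_im]
    nlinarith
  have hpre : Real.exp (-(Real.pi * τ.im)) ≤
      ‖Complex.exp (Real.pi * Complex.I * ((τ : ℂ) / 4 - (r * (τ : ℂ) + s)))‖ := by
    rw [norm_exp_pi_mul_I_mul, Real.exp_le_exp, Complex.sub_im, him]
    have : ((τ : ℂ) / 4).im = τ.im / 4 := by simp
    rw [this]
    nlinarith [mul_nonneg hr0 τ.im_pos.le, mul_pos Real.pi_pos τ.im_pos,
      mul_nonneg Real.pi_pos.le (mul_nonneg hr0 τ.im_pos.le)]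
  rw [oddTheta_eq_prod _ τ.im_pos]
  generalize Complex.exp (2 * Real.pi * Complex.I * (τ : ℂ)) = q at *
  generalize Complex.exp (2 * Real.pi * Complex.I * (r * (τ : ℂ) + s)) = x at *
  have hq2 : ‖q‖ ≤ 1 / 2 := hq4.trans (by norm_num)
  have b1 := half_le_norm_qInf hq2 hq4
  have b2 := half_le_norm_qInf hq2 hqx
  have b3 : 1 / 2 ≤ ‖qInf (x * q) q‖ := half_le_norm_qInf hq2 (by
    rw [norm_mul]
    exact (mul_le_of_le_one_left (norm_nonneg _) hx1).trans hq4)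
  rw [qInf_eq_mul (hq2.trans_lt (by norm_num)) x, norm_mul, norm_mul, norm_mul, norm_mul]
  calc Real.exp (-((Real.pi + (δ / 8)⁻¹) * τ.im))
      = Real.exp (-(Real.pi * τ.im)) * Real.exp (-((δ / 8)⁻¹ * τ.im)) := by
        rw [← Real.exp_add]; ring_nf
    _ ≤ Real.exp (-(Real.pi * τ.im)) * (δ / 8) := by
        gcongr
        refine le_trans (Real.exp_le_exp.2 ?_) (exp_neg_inv_le (by positivity))
        have : 0 < (δ / 8)⁻¹ := by positivity
        nlinarith
    _ = Real.exp (-(Real.pi * τ.im)) * (1 / 2 * (δ * (1 / 2)) * (1 / 2)) := by ring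
    _ ≤ _ := by gcongr

/-- Off the lattice, `oddTheta` decays at most like a power of `q` along `z = r τ + s`. -/
theorem oddTheta_lower_bound (r s : ℝ) (h : ¬ ((∃ n : ℤ, r = n) ∧ ∃ m : ℤ, s = m)) :
    ∃ C A : ℝ, ∀ τ : ℍ, A ≤ τ.im →
      Real.exp (-(C * τ.im)) ≤ ‖oddTheta (r * (τ : ℂ) + s) τ‖ := by
  obtain ⟨C, A, hC⟩ := oddTheta_lower_bound_of_mem_Ico (Int.fract_nonneg r) (Int.fract_lt_one r) s
    (fun h' => h ⟨⟨⌊r⌋, by have := Int.floor_add_fract r; rw [h'.1] at this; linarith⟩, h'.2⟩)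
  -- The correction is the exponent of the quasi-periodicity factor for the shift by `⌊r⌋ τ`.
  refine ⟨C - Real.pi * (⌊r⌋ ^ 2 + 2 * ⌊r⌋ * Int.fract r), A, fun τ hτ => ?_⟩
  have e : (r : ℂ) * (τ : ℂ) + s = (Int.fract r : ℝ) * (τ : ℂ) + s + (⌊r⌋ : ℤ) * (τ : ℂ) +
      ((0 : ℤ) : ℂ) := by
    have : (r : ℂ) = (⌊r⌋ : ℤ) + (Int.fract r : ℝ) := by
      exact_mod_cast (Int.floor_add_fract r).symm
    rw [Int.cast_zero, add_zero]
    linear_combination (τ : ℂ) * this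
  rw [e, oddTheta_add_lattice, norm_mul, norm_mul, norm_zpow, norm_neg, norm_one, one_zpow, one_mul,
    ← mul_neg (Real.pi * Complex.I : ℂ), norm_exp_pi_mul_I_mul]
  have e2 : (-((⌊r⌋ : ℂ) ^ 2 * (τ : ℂ) + 2 * (⌊r⌋ : ℂ) *
      ((Int.fract r : ℝ) * (τ : ℂ) + s))).im = -((⌊r⌋ ^ 2 + 2 * ⌊r⌋ * Int.fract r) * τ.im) := by
    rw [show (-((⌊r⌋ : ℂ) ^ 2 * (τ : ℂ) + 2 * (⌊r⌋ : ℂ) * ((Int.fract r : ℝ) * (τ : ℂ) + s))) =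
      ((-(⌊r⌋ ^ 2 + 2 * ⌊r⌋ * Int.fract r) : ℝ) : ℂ) * (τ : ℂ) + ((-2 * ⌊r⌋ * s : ℝ) : ℂ) by
        push_cast; ring]
    rw [Complex.add_im, Complex.im_ofReal_mul, Complex.ofReal_im, UpperHalfPlane.coe_im]
    ring
  rw [e2]
  calc _ = Real.exp (-(Real.pi * -((⌊r⌋ ^ 2 + 2 * ⌊r⌋ * Int.fract r) * τ.im))) *
        Real.exp (-(C * τ.im)) := by rw [← Real.exp_add]; ring_nf
    _ ≤ _ := by
        gcongr
        exact hC τ hτ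

/-- Both bounds come from the discriminant `η^24`: it tends to 0, and it is at least a constant
times `exp (-2π Im τ)`. The constant is absorbed in an extra `exp (-Im τ)`, and `|η|^24 ≤ |η|^2`
once `|η| ≤ 1`. -/
lemma eta_bounds : ∃ A : ℝ, ∀ τ : ℍ, A ≤ τ.im → ‖ModularForm.eta (τ : ℂ)‖ ≤ 1 ∧
    Real.exp (-((2 * Real.pi + 1) * τ.im)) ≤ ‖ModularForm.eta (τ : ℂ)‖ ^ 2 := by
  obtain ⟨C, hC⟩ := ModularForm.exp_isBigO_discriminant.bound
  obtain ⟨A₁, h₁⟩ := (UpperHalfPlane.atImInfty_mem _).1 hC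
  have h0 : Tendsto ModularForm.discriminant UpperHalfPlane.atImInfty (𝓝 0) :=
    ModularForm.discriminant_isZeroAtImInfty
  have h0' := h0.norm.eventually_le_const (by simp : ‖(0 : ℂ)‖ < 1)
  obtain ⟨A₂, h₂⟩ := (UpperHalfPlane.atImInfty_mem _).1 h0'
  refine ⟨max (max A₁ A₂) C, fun τ hτ => ?_⟩
  have y1 := h₁ τ ((le_max_left _ _).trans ((le_max_left _ _).trans hτ))
  have y2 := h₂ τ ((le_max_right _ _).trans ((le_max_left _ _).trans hτ))
  have y3 := (le_max_right _ _).trans hτ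
  simp only [Set.mem_ofPred_eq, ModularForm.discriminant, norm_pow, Real.norm_eq_abs,
    Real.abs_exp] at y1 y2
  have hle : ‖ModularForm.eta (τ : ℂ)‖ ≤ 1 := (pow_le_one_iff_of_nonneg (norm_nonneg _) (by norm_num)).1 y2
  refine ⟨hle, ?_⟩
  have h24 : ‖ModularForm.eta (τ : ℂ)‖ ^ 24 ≤ ‖ModularForm.eta (τ : ℂ)‖ ^ 2 :=
    pow_le_pow_of_le_one (norm_nonneg _) hle (by norm_num)
  have hC' : C ≤ Real.exp τ.im := by
    have := Real.add_one_le_exp τ.im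
    linarith
  calc Real.exp (-((2 * Real.pi + 1) * τ.im))
      = Real.exp (-τ.im) * Real.exp (-2 * Real.pi * τ.im) := by rw [← Real.exp_add]; ring_nf
    _ ≤ Real.exp (-τ.im) * (Real.exp τ.im * ‖ModularForm.eta (τ : ℂ)‖ ^ 24) := by
        gcongr
        refine y1.trans ?_
        gcongr
    _ = ‖ModularForm.eta (τ : ℂ)‖ ^ 24 := by
        rw [← mul_assoc, ← Real.exp_add, neg_add_cancel, Real.exp_zero, one_mul]
    _ ≤ _ := h24

lemma norm_eq_sqrt_of_pow {x y : ℂ} {n : ℕ} (hn : n ≠ 0) (h : x ^ (2 * n) = y ^ n) :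
    ‖x‖ = √‖y‖ := by
  have e : (‖x‖ ^ 2) ^ n = ‖y‖ ^ n := by rw [← pow_mul, ← norm_pow, h, norm_pow]
  rw [← (pow_left_inj₀ (by positivity) (by positivity) hn).1 e, Real.sqrt_sq (norm_nonneg x)]

lemma Doubling.im_σ {γ : SL(2, ℤ)} (D : Doubling γ) (τ : ℍ) : (D.σ τ).im = D.A * τ.im := by
  rw [← UpperHalfPlane.coe_im, D.coe_σ]
  simp

/-- All `SL₂(ℤ)`-translates of `g2Sum` grow at most like a power of `q⁻¹` along `z = r τ + s`. -/
theorem g2Sum_growth (γ : SL(2, ℤ)) (r s : ℝ) : ∃ C A : ℝ, ∀ τ : ℍ, A ≤ τ.im →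
    oddTheta (2 * ((r * (τ : ℂ) + s) / autDenom γ τ)) (2 * ((γ • τ : ℍ) : ℂ)) ≠ 0 →
    ‖autDenom γ τ ^ (-(1 / 2) : ℂ) *
      Complex.exp (2 * Real.pi * Complex.I * ((γ 1 0 : ℤ) : ℂ) * (r * (τ : ℂ) + s) ^ 2 /
        autDenom γ τ) *
      g2Sum ((r * (τ : ℂ) + s) / autDenom γ τ, ((γ • τ : ℍ) : ℂ))‖ ≤ Real.exp (C * τ.im) := by
  obtain ⟨D⟩ := nonempty_doubling γ
  obtain ⟨K, L, J, -, hK, hL, hJ, h⟩ := exists_g2Sum_smul D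
  have hA0 := D.A_pos
  have hκ0 := D.κ_pos
  have hz : ∀ τ : ℍ, 2 * (D.κ : ℂ) * (r * (τ : ℂ) + s) = ((2 * D.κ * r / D.A : ℝ) : ℂ) *
      ((D.σ τ : ℍ) : ℂ) + ((2 * D.κ * s - 2 * D.κ * r / D.A * D.B : ℝ) : ℂ) := fun τ => by
    have : (D.A : ℂ) ≠ 0 := by exact_mod_cast hA0.ne'
    rw [D.coe_σ]
    push_cast
    field_simp
    ring
  -- If the curve runs through lattice points, theta vanishes identically along it and the claim is
  -- vacuous.
  by_cases hrs : (∃ n : ℤ, 2 * D.κ * r / D.A = n) ∧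
      ∃ m : ℤ, 2 * D.κ * s - 2 * D.κ * r / D.A * D.B = m
  · obtain ⟨⟨n, hn⟩, m, hm⟩ := hrs
    refine ⟨0, 0, fun τ _ h0 => ((h _ τ h0).1 ?_).elim⟩
    rw [hz, hm, hn]
    simpa using oddTheta_lattice n m (D.σ τ)
  obtain ⟨C, A₁, hC⟩ := oddTheta_lower_bound _ _ hrs
  obtain ⟨A₂, hA₂⟩ := eta_bounds
  set k : ℝ := √D.κ with hk
  have hk0 : 0 < k := Real.sqrt_pos.2 hκ0
  -- The summands bound the constant left when all powers of `|cτ + d|` cancel, the factor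
  -- `η(τ)^{-2}`, and the reciprocal of theta at `σ τ`, whose height is `A Im τ`.
  refine ⟨2 * k ^ 3 + (2 * Real.pi + 1) + C * D.A, max (max (A₁ / D.A) (A₂ / D.A)) (max A₂ 1),
    fun τ hτ h0 => ?_⟩
  have y1 : A₁ ≤ (D.σ τ).im := by
    have : A₁ / D.A ≤ τ.im := (le_max_left _ _).trans ((le_max_left _ _).trans hτ)
    rw [div_le_iff₀' hA0] at this
    rwa [D.im_σ]
  have y2 : A₂ ≤ (D.σ τ).im := by
    have : A₂ / D.A ≤ τ.im := (le_max_right _ _).trans ((le_max_left _ _).trans hτ)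
    rw [div_le_iff₀' hA0] at this
    rwa [D.im_σ]
  have y3 : A₂ ≤ τ.im := (le_max_left _ _).trans ((le_max_right _ _).trans hτ)
  have y4 : 1 ≤ τ.im := (le_max_right _ _).trans ((le_max_right _ _).trans hτ)
  obtain ⟨hθ, hg⟩ := h _ τ h0
  have hd := autDenom_ne_zero γ τ
  have hexp : ∀ u : ℂ, Complex.exp u * Complex.exp (-u) = 1 := fun u => by
    rw [← Complex.exp_add, add_neg_cancel, Complex.exp_zero]
  set x : ℝ := √‖autDenom γ τ‖ with hx
  have hx0 : 0 < x := Real.sqrt_pos.2 (norm_pos_iff.2 hd)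
  have hκd : √‖(D.κ : ℂ) * autDenom γ τ‖ = k * x := by
    rw [norm_mul, Complex.norm_real, Real.norm_of_nonneg hκ0.le, Real.sqrt_mul hκ0.le]
  have nK : ‖K τ‖ = k * x := by
    rw [← hκd]; exact norm_eq_sqrt_of_pow (n := 12) (by norm_num) (hK τ)
  have nL : ‖L τ‖ = x := norm_eq_sqrt_of_pow (n := 12) (by norm_num) (hL τ)
  have nJ : ‖J τ‖ = k * x := by
    rw [← hκd]; exact norm_eq_sqrt_of_pow (n := 4) (by norm_num) (hJ τ)
  have nP : ‖autDenom γ τ ^ (-(1 / 2) : ℂ)‖ = x⁻¹ := by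
    rw [Complex.cpow_neg, norm_inv, norm_eq_sqrt_of_pow (y := autDenom γ τ) one_ne_zero (by
      rw [← Complex.cpow_nat_mul, show ((2 * 1 : ℕ) : ℂ) * (1 / 2) = (1 : ℕ) by norm_num,
        Complex.cpow_natCast])]
  have e1 := (hA₂ _ y2).1
  have e2 := (hA₂ _ y3).2
  have e3 := hC _ y1
  rw [← hz, D.im_σ] at e3
  rw [hg, ← mul_assoc, mul_comm (K τ ^ 4 / _), ← mul_assoc, mul_assoc (autDenom γ τ ^ _), hexp,
    mul_one, norm_mul, norm_mul, nP, norm_div, norm_div, norm_mul, norm_mul, norm_mul, norm_pow,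
    norm_pow, norm_pow, norm_pow, nK, nL, nJ, RCLike.norm_ofNat]
  calc x⁻¹ * ((k * x) ^ 4 / (x ^ 2 * (k * x))) * (2 * ‖ModularForm.eta ((D.σ τ : ℍ) : ℂ)‖ ^ 4 /
        (‖ModularForm.eta (τ : ℂ)‖ ^ 2 *
          ‖oddTheta (2 * D.κ * (r * (τ : ℂ) + s)) ((D.σ τ : ℍ) : ℂ)‖))
      = 2 * k ^ 3 * (‖ModularForm.eta ((D.σ τ : ℍ) : ℂ)‖ ^ 4 /
        (‖ModularForm.eta (τ : ℂ)‖ ^ 2 *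
          ‖oddTheta (2 * D.κ * (r * (τ : ℂ) + s)) ((D.σ τ : ℍ) : ℂ)‖)) := by
        field_simp
    _ ≤ Real.exp (2 * k ^ 3 * τ.im) * (1 / (Real.exp (-((2 * Real.pi + 1) * τ.im)) *
          Real.exp (-(C * (D.A * τ.im))))) := by
        gcongr
        · have h1 := Real.add_one_le_exp (2 * k ^ 3 * τ.im)
          have h2 : 0 < 2 * k ^ 3 := by positivity
          nlinarith
        · exact pow_le_one₀ (norm_nonneg _) e1
    _ = _ := by
        rw [← Real.exp_add, one_div, ← Real.exp_neg, ← Real.exp_add]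
        ring_nf

/-! ### The Jacobi form -/

theorem isMeromorphicJacobiForm_g2Sum :
    IsMeromorphicJacobiForm (CongruenceSubgroup.Gamma0 2) (1 / 2) (-1)
      (fun l _ => (-1 : ℂ) ^ l) g2Sum where
  finiteIndex := inferInstance
  meromorphic z τ := meromorphicNear_g2Sum z τ.im_pos
  elliptic l n z τ h _ := by
    rw [g2Sum_elliptic l n z τ.im_pos (oddTheta_ne_zero_of_analyticAt τ.im_pos h)]
    congr 3
    push_cast
    ring
  modular := by
    classical
    choose v hv hv' using fun γ : CongruenceSubgroup.Gamma0 2 => g2Sum_modular γ.2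
    refine ⟨fun γ => if h : γ ∈ CongruenceSubgroup.Gamma0 2 then v ⟨γ, h⟩ else 1,
      ⟨24, by norm_num, fun γ hγ => by beta_reduce; rw [dif_pos hγ]; exact hv _⟩, fun γ hγ z τ h1 h2 => ?_⟩
    beta_reduce
    rw [dif_pos hγ, hv' ⟨γ, hγ⟩ z τ (oddTheta_ne_zero_of_analyticAt τ.im_pos h1)
      (oddTheta_ne_zero_of_analyticAt (γ • τ).im_pos h2)]
    congr 2
    · push_cast
      rfl
    · congr 1
      push_cast
      ring
  growth γ r s := by
    obtain ⟨C, A, h⟩ := g2Sum_growth γ r s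
    refine ⟨C, A, fun τ hτ ha => ?_⟩
    convert h τ hτ (oddTheta_ne_zero_of_analyticAt (γ • τ).im_pos ha) using 4
    · push_cast
      rfl
    · congr 1
      push_cast
      ring

/-! ### The theta quotient -/

lemma qInf_even_odd {q : ℂ} (hq : ‖q‖ < 1) (a : ℂ) :
    qInf a (q ^ 2) * qInf (a * q) (q ^ 2) = qInf a q := by
  have hq2 : ‖q ^ 2‖ < 1 := by
    rw [norm_pow]; exact pow_lt_one₀ (norm_nonneg q) hq two_ne_zero
  have e1 : ∀ j : ℕ, 1 - a * (q ^ 2) ^ j = 1 - a * q ^ (2 * j) := fun j => by rw [pow_mul]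
  have e2 : ∀ j : ℕ, 1 - a * q * (q ^ 2) ^ j = 1 - a * q ^ (2 * j + 1) := fun j => by
    rw [pow_succ q (2 * j), pow_mul]; ring
  rw [qInf, qInf, qInf, ← tprod_even_mul_odd (f := fun j : ℕ => 1 - a * q ^ j)
    (by simpa only [e1] using multipliable_one_sub_mul_pow hq2 a)
    (by simpa only [e2] using multipliable_one_sub_mul_pow hq2 (a * q)), tprod_congr e1,
    tprod_congr e2]

/-- By the triple product, `θ` gives `(q²; q²)_∞ (-q; q²)_∞²` and `ϑ(1/2; 2τ)` gives `-2i q^{1/4}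
(q²; q²)_∞ (-q²; q²)_∞²`; even and odd factors merge into `(-q; q)_∞ = (q²; q²)_∞ / (q; q)_∞`. -/
lemma etaQuot_eq_thetaHalf_mul (τ : ℍ) :
    etaQuot τ = Complex.I * thetaHalf τ * oddTheta (1 / 2) (2 * (τ : ℂ)) := by
  have hτ2 := im_two_mul_pos τ.im_pos
  have hq := norm_exp_two_pi_mul_I_mul_lt_one τ.im_pos
  have hη := eta_eq_qInf τ
  have hη2 := eta_eq_qInf (2 * τ)
  have hθ := oddTheta_eq_prod (1 / 2) hτ2
  -- For modulus `2τ`, this argument places `jacobiTheta₂` at the origin, where it is `θ(τ)`.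
  have hj := jacobiTheta₂_eq_prod ((τ : ℂ) - 1 / 2) hτ2
  have eq2 : Complex.exp (2 * Real.pi * Complex.I * (2 * τ)) =
      Complex.exp (2 * Real.pi * Complex.I * τ) ^ 2 := by
    rw [← Complex.exp_nat_mul]; congr 1; push_cast; ring
  have e1 : Complex.exp (2 * Real.pi * Complex.I * (2 * τ) / 24) =
      Complex.exp (2 * Real.pi * Complex.I * τ / 24) ^ 2 := by
    rw [← Complex.exp_nat_mul]; congr 1; push_cast; ring
  have e2 : Complex.exp (Real.pi * Complex.I * (2 * τ / 4 - 1 / 2)) =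
      Complex.exp (2 * Real.pi * Complex.I * τ / 24) ^ 6 * -Complex.I := by
    rw [← Complex.exp_neg_pi_div_two_mul_I, ← Complex.exp_nat_mul, ← Complex.exp_add]
    congr 1; push_cast; ring
  have e3 : Complex.exp (2 * Real.pi * Complex.I * (1 / 2)) = -1 := by
    rw [← Complex.exp_pi_mul_I]; congr 1; ring
  have e4 : Complex.exp (2 * Real.pi * Complex.I * ((τ : ℂ) - 1 / 2)) =
      -Complex.exp (2 * Real.pi * Complex.I * τ) := by
    rw [mul_sub, Complex.exp_sub, e3, div_neg, div_one]
  rw [show (τ : ℂ) - 1 / 2 - 2 * τ / 2 + 1 / 2 = 0 by ring, ← jacobiTheta_eq_jacobiTheta₂, eq2,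
    e4] at hj
  rw [eq2, e2, e3] at hθ
  rw [e1, eq2] at hη2
  rw [etaQuot, thetaHalf, hη, hη2, hθ, hj]
  have hE : Complex.exp (2 * Real.pi * Complex.I * τ / 24) ≠ 0 := Complex.exp_ne_zero _
  have hq0 : Complex.exp (2 * Real.pi * Complex.I * (τ : ℂ)) ≠ 0 := Complex.exp_ne_zero _
  generalize Complex.exp (2 * Real.pi * Complex.I * (τ : ℂ) / 24) = E at *
  generalize Complex.exp (2 * Real.pi * Complex.I * (τ : ℂ)) = q at *
  have hq2 : ‖q ^ 2‖ < 1 := by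
    rw [norm_pow]; exact pow_lt_one₀ (norm_nonneg q) hq two_ne_zero
  have n3 := qInf_self_ne_zero hq
  have hN := eq_div_of_mul_eq n3 (qInf_neg_mul_qInf hq)
  rw [← qInf_even_odd hq (-q), eq_comm, show -q * q = -q ^ 2 by ring] at hN
  have hI := Complex.I_sq
  rw [qInf_eq_mul hq2 (-1), show q ^ 2 / -q = -q by field_simp, div_neg, div_one, neg_one_mul]
  rw [div_eq_iff n3] at hN
  rw [hN]
  have n5 : qInf (-q) (q ^ 2) * qInf (-q ^ 2) (q ^ 2) ≠ 0 := by
    intro h0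
    rw [h0, zero_mul] at hN
    exact qInf_self_ne_zero hq2 hN
  field_simp
  rw [hI]
  ring

/-- The factor `q^{-r²}` compensates the Jacobi exponential: under `γ` the pair `(r, s)` becomes
`(r, s)γ`, up to a constant independent of `τ`. -/
lemma automorphy_exponent (γ : SL(2, ℤ)) (r s : ℂ) (τ : ℍ) :
    r ^ 2 * ((γ • τ : ℍ) : ℂ) + ((γ 1 0 : ℤ) : ℂ) *
      ((r * (γ 0 0 : ℤ) + s * (γ 1 0 : ℤ)) * τ + (r * (γ 0 1 : ℤ) + s * (γ 1 1 : ℤ))) ^ 2 /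
        autDenom γ τ =
    (r * (γ 0 0 : ℤ) + s * (γ 1 0 : ℤ)) ^ 2 * τ + (r ^ 2 * (γ 0 0 : ℤ) * (γ 0 1 : ℤ) +
      2 * r * s * (γ 0 1 : ℤ) * (γ 1 0 : ℤ) + s ^ 2 * (γ 1 0 : ℤ) * (γ 1 1 : ℤ)) := by
  have h0 := autDenom_ne_zero γ τ
  have h1 : autDenom γ τ = ((γ 1 0 : ℤ) : ℂ) * τ + ((γ 1 1 : ℤ) : ℂ) := rfl
  rw [coe_sl_smul, ← mul_div_assoc, ← add_div, div_eq_iff h0, h1]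
  linear_combination (-(r ^ 2 * (((γ 0 0 : ℤ) : ℂ) * τ + ((γ 0 1 : ℤ) : ℂ)))) * sl_det_complex γ

lemma torsion_smul (γ : SL(2, ℤ)) (r s : ℂ) (τ : ℍ) :
    r * ((γ • τ : ℍ) : ℂ) + s = ((r * (γ 0 0 : ℤ) + s * (γ 1 0 : ℤ)) * τ +
      (r * (γ 0 1 : ℤ) + s * (γ 1 1 : ℤ))) / autDenom γ τ := by
  have h0 := autDenom_ne_zero γ τ
  rw [coe_sl_smul, eq_div_iff h0, add_mul, mul_assoc, div_mul_cancel₀ _ h0, autDenom]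
  ring

/-- The theta quotient `q^{-r²} ϑ(1/2; 2τ) / ϑ(2(rτ+s); 2τ)`. -/
noncomputable def thetaQuot (r s : ℂ) (τ : ℍ) : ℂ :=
  Complex.exp (-2 * Real.pi * Complex.I * r ^ 2 * τ) * oddTheta (1 / 2) (2 * τ) /
    oddTheta (2 * (r * τ + s)) (2 * τ)

lemma exp_eq_one_of_int {x : ℂ} (n : ℤ) (h : x = 2 * Real.pi * Complex.I * n) :
    Complex.exp x = 1 :=
  Complex.exp_eq_one_iff.2 ⟨n, by rw [h]; ring⟩

/-- Numerator and denominator acquire the same factor `J τ`, which cancels. The congruences move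
both arguments by lattice vectors with even coordinates, so no signs arise, and make the surviving
constants integral multiples of `2πi`. -/
lemma thetaQuot_smul {R S D M a' b' c' d' : ℤ} (hD : D ≠ 0) (hM : M ≠ 0) {γ : SL(2, ℤ)}
    (ha : γ 0 0 = 1 + 16 * D ^ 2 * M ^ 2 * a') (hb : γ 0 1 = 16 * D ^ 2 * M ^ 2 * b')
    (hc : γ 1 0 = 16 * D ^ 2 * M ^ 2 * c') (hd : γ 1 1 = 1 + 16 * D ^ 2 * M ^ 2 * d') (τ : ℍ) :
    thetaQuot (R / D) (S / M) (γ • τ) = thetaQuot (R / D) (S / M) τ := by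
  have hD' : (D : ℂ) ≠ 0 := by exact_mod_cast hD
  have hM' : (M : ℂ) ≠ 0 := by exact_mod_cast hM
  have ha' : ((γ 0 0 : ℤ) : ℂ) = 1 + 16 * D ^ 2 * M ^ 2 * a' := by exact_mod_cast ha
  have hb' : ((γ 0 1 : ℤ) : ℂ) = 16 * D ^ 2 * M ^ 2 * b' := by exact_mod_cast hb
  have hc' : ((γ 1 0 : ℤ) : ℂ) = 16 * D ^ 2 * M ^ 2 * c' := by exact_mod_cast hc
  have hd' : ((γ 1 1 : ℤ) : ℂ) = 1 + 16 * D ^ 2 * M ^ 2 * d' := by exact_mod_cast hd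
  let E := Doubling.ofEven γ (8 * D ^ 2 * M ^ 2 * c') (by rw [hc]; ring)
  obtain ⟨J, -, hJ8, h⟩ := E.exists_oddTheta
  have hκ : (E.κ : ℂ) = 1 := Complex.ofReal_one
  have hσ : ((E.σ τ : ℍ) : ℂ) = 2 * τ := by
    rw [E.coe_σ]
    simp [E, Doubling.ofEven]
  have h0 := autDenom_ne_zero γ τ
  have hJ0 : J τ ≠ 0 := ne_zero_of_pow_eq (hJ8 τ) (by norm_num) (by rw [hκ, one_mul]; exact h0)
  have hden : autDenom γ τ = ((γ 1 0 : ℤ) : ℂ) * τ + ((γ 1 1 : ℤ) : ℂ) := rfl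
  -- the numerator
  have hn : oddTheta (1 / 2) (2 * ((γ • τ : ℍ) : ℂ)) = J τ * oddTheta (1 / 2) (2 * τ) := by
    -- Chosen so that the transformed argument `2z / (cτ + d)` is `1/2`.
    have e := h (autDenom γ τ / 4) τ
    have e1 : 2 * (autDenom γ τ / 4 / autDenom γ τ) = 1 / 2 := by field_simp; norm_num
    have e2 : 2 * (E.κ : ℂ) * (autDenom γ τ / 4) = 1 / 2 +
        ((2 * (2 * D ^ 2 * M ^ 2 * c') : ℤ) : ℂ) * (2 * τ) +
          ((2 * (4 * D ^ 2 * M ^ 2 * d') : ℤ) : ℂ) := by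
      rw [hκ, hden, hc', hd']; push_cast; ring
    rw [e1, hσ, e2, oddTheta_add_lattice, ← mul_add, zpow_mul,
      show ((-1 : ℂ) ^ (2 : ℤ)) = 1 by norm_num, one_zpow, one_mul, ← mul_assoc,
      mul_assoc (J τ), ← Complex.exp_add] at e
    rw [e, exp_eq_one_of_int (D ^ 2 * M ^ 2 * c' * (16 * D ^ 2 * M ^ 2 * d' - 1)), mul_one]
    rw [hden, div_pow] at *
    have h4 : 2 * Real.pi * Complex.I * ((γ 1 0 : ℤ) : ℂ) *
        ((((γ 1 0 : ℤ) : ℂ) * τ + ((γ 1 1 : ℤ) : ℂ)) ^ 2 / 4 ^ 2) /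
        (((γ 1 0 : ℤ) : ℂ) * τ + ((γ 1 1 : ℤ) : ℂ)) = Real.pi * Complex.I * ((γ 1 0 : ℤ) : ℂ) *
        (((γ 1 0 : ℤ) : ℂ) * τ + ((γ 1 1 : ℤ) : ℂ)) / 8 := by
      field_simp
      ring
    rw [h4, hc', hd']
    push_cast
    ring
  -- the denominator
  have hm := h ((R / D * (γ 0 0 : ℤ) + S / M * (γ 1 0 : ℤ)) * τ +
    (R / D * (γ 0 1 : ℤ) + S / M * (γ 1 1 : ℤ))) τ
  have e2 : 2 * (E.κ : ℂ) * ((R / D * (γ 0 0 : ℤ) + S / M * (γ 1 0 : ℤ)) * τ +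
      (R / D * (γ 0 1 : ℤ) + S / M * (γ 1 1 : ℤ))) = 2 * (R / D * τ + S / M) +
        ((2 * (8 * (D * M ^ 2 * R * a' + D ^ 2 * M * S * c')) : ℤ) : ℂ) * (2 * τ) +
        ((2 * (16 * (D * M ^ 2 * R * b' + D ^ 2 * M * S * d')) : ℤ) : ℂ) := by
    rw [hκ, ha', hb', hc', hd']
    push_cast
    field_simp
    ring
  rw [← torsion_smul, hσ, e2, oddTheta_add_lattice, ← mul_add, zpow_mul,
    show ((-1 : ℂ) ^ (2 : ℤ)) = 1 by norm_num, one_zpow, one_mul, ← mul_assoc,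
    mul_assoc (J τ), ← Complex.exp_add] at hm
  rw [thetaQuot, thetaQuot, hn, hm]
  have hau := automorphy_exponent γ (R / D) (S / M) τ
  have key : Complex.exp (-2 * Real.pi * Complex.I * (R / D) ^ 2 * ((γ • τ : ℍ) : ℂ)) =
      Complex.exp (-2 * Real.pi * Complex.I * (R / D) ^ 2 * τ) * Complex.exp
        (2 * Real.pi * Complex.I * ((γ 1 0 : ℤ) : ℂ) *
        ((R / D * (γ 0 0 : ℤ) + S / M * (γ 1 0 : ℤ)) * τ +
          (R / D * (γ 0 1 : ℤ) + S / M * (γ 1 1 : ℤ))) ^ 2 / autDenom γ τ +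
        -(Real.pi * Complex.I *
          (((2 * (8 * (D * M ^ 2 * R * a' + D ^ 2 * M * S * c')) : ℤ) : ℂ) ^ 2 * (2 * τ) +
            2 * ((2 * (8 * (D * M ^ 2 * R * a' + D ^ 2 * M * S * c')) : ℤ) : ℂ) *
              (2 * (R / D * τ + S / M))))) := by
    rw [← Complex.exp_add]
    -- The negative of the constant in `automorphy_exponent`, plus `2 l s` from the
    -- quasi-periodicity factor with `l` the shift of `r`; the divisibility by `D² M²` makes it an
    -- integer.
    refine Complex.exp_eq_exp_iff_exists_int.2 ⟨-(R ^ 2 * (γ 0 0) * (16 * M ^ 2 * b') +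
      2 * R * S * (16 * D * M * b') * (γ 1 0) + S ^ 2 * (16 * D ^ 2 * c') * (γ 1 1)) +
      2 * (16 * (D * M * R * S * a' + D ^ 2 * S ^ 2 * c')), ?_⟩
    have hR : (R : ℂ) = R / D * D := by field_simp
    have hS : (S : ℂ) = S / M * M := by field_simp
    push_cast
    generalize (R / D * ((γ 0 0 : ℤ) : ℂ) + S / M * ((γ 1 0 : ℤ) : ℂ)) * (τ : ℂ) +
      (R / D * ((γ 0 1 : ℤ) : ℂ) + S / M * ((γ 1 1 : ℤ) : ℂ)) = Z at *
    generalize (R : ℂ) / D = r at *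
    generalize (S : ℂ) / M = s at *
    rw [hR, hS, hd']
    rw [ha', hb', hc', hd'] at hau
    rw [ha', hc']
    linear_combination (-2 * Real.pi * Complex.I) * hau
  rw [key]
  have := Complex.exp_ne_zero (2 * Real.pi * Complex.I * ((γ 1 0 : ℤ) : ℂ) *
        ((R / D * (γ 0 0 : ℤ) + S / M * (γ 1 0 : ℤ)) * τ +
          (R / D * (γ 0 1 : ℤ) + S / M * (γ 1 1 : ℤ))) ^ 2 / autDenom γ τ +
        -(Real.pi * Complex.I *
          (((2 * (8 * (D * M ^ 2 * R * a' + D ^ 2 * M * S * c')) : ℤ) : ℂ) ^ 2 * (2 * τ) +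
            2 * ((2 * (8 * (D * M ^ 2 * R * a' + D ^ 2 * M * S * c')) : ℤ) : ℂ) *
              (2 * (R / D * τ + S / M)))))
  field_simp

/-! ### Specialization to torsion points -/

/-- Comparing imaginary and then real parts, `2(rτ + s)` lies in `ℤ 2τ + ℤ` only in the excluded
case, so there are no poles on `ℍ`. -/
lemma oddTheta_torsion_ne_zero {r s : ℚ} (h : ¬ ((∃ n : ℤ, r = n) ∧ ∃ m : ℤ, 2 * s = m)) (τ : ℍ) :
    oddTheta (2 * ((r : ℂ) * (τ : ℂ) + (s : ℂ))) (2 * (τ : ℂ)) ≠ 0 := by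
  intro h0
  obtain ⟨n, m, e⟩ := (oddTheta_eq_zero_iff (im_two_mul_pos τ.im_pos)).1 h0
  have e' : (((2 * r - 2 * n : ℚ) : ℝ) : ℂ) * (τ : ℂ) = (((m - 2 * s : ℚ) : ℝ) : ℂ) := by
    push_cast; linear_combination e
  have e1 := congrArg Complex.im e'
  rw [Complex.im_ofReal_mul, Complex.ofReal_im, UpperHalfPlane.coe_im] at e1
  have e2 := (mul_eq_zero.1 e1).resolve_right τ.im_pos.ne'
  rw [e2, Complex.ofReal_zero, zero_mul, eq_comm, Complex.ofReal_eq_zero] at e'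
  have e3 : (2 * r - 2 * n : ℚ) = 0 := by exact_mod_cast e2
  have e4 : (m - 2 * s : ℚ) = 0 := by exact_mod_cast e'
  exact h ⟨⟨n, by linarith⟩, m, by linarith⟩

/-- The specialization of `g2Sum` to the torsion point `r τ + s`, normalized by `q^{-r²}`. -/
noncomputable def g2Torsion (r s : ℂ) (τ : ℍ) : ℂ :=
  Complex.exp (-2 * Real.pi * Complex.I * r ^ 2 * (τ : ℂ)) * g2Sum (r * (τ : ℂ) + s, (τ : ℂ))

lemma g2Torsion_eq {r s : ℂ} {τ : ℍ} (h : oddTheta (2 * (r * (τ : ℂ) + s)) (2 * (τ : ℂ)) ≠ 0) :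
    g2Torsion r s τ = Complex.I * thetaHalf τ * thetaQuot r s τ := by
  rw [g2Torsion, g2Sum_eq τ.im_pos h, etaQuot_eq_thetaHalf_mul, thetaQuot]
  ring

lemma mdifferentiable_g2Torsion {r s : ℂ}
    (h : ∀ τ : ℍ, oddTheta (2 * (r * (τ : ℂ) + s)) (2 * (τ : ℂ)) ≠ 0) :
    MDifferentiable 𝓘(ℂ) 𝓘(ℂ) (g2Torsion r s) := by
  rw [UpperHalfPlane.mdifferentiable_iff]
  have hd : DifferentiableOn ℂ (fun t : ℂ => Complex.exp (-2 * Real.pi * Complex.I * r ^ 2 * t) *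
      (etaQuot t / oddTheta (2 * (r * t + s)) (2 * t))) {t | 0 < t.im} := by
    intro t ht
    refine DifferentiableAt.differentiableWithinAt ?_
    have h1 : DifferentiableAt ℂ (fun t : ℂ => oddTheta (2 * (r * t + s)) (2 * t)) t :=
      (analyticAt_oddTheta_two_mul (r * t + s) ht).differentiableAt.comp t
        (f := fun t : ℂ => (r * t + s, t)) (by fun_prop)
    exact DifferentiableAt.mul (by fun_prop) ((differentiableAt_etaQuot ht).div h1 (h ⟨t, ht⟩))
  refine hd.congr fun t ht => ?_
  rw [Function.comp_apply, UpperHalfPlane.ofComplex_apply_of_im_pos ht, g2Torsion,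
    g2Sum_eq (UpperHalfPlane.im_pos ⟨t, ht⟩) (h ⟨t, ht⟩)]

/-- The growth of `g2Sum` is used along the curve with parameters `(r, s)γ`; by
`automorphy_exponent` the normalization costs only the absolute value of a power of `q` with
exponent minus the square of the new `r`. -/
lemma g2Torsion_growth {r s : ℝ} (γ : SL(2, ℤ))
    (h : ∀ τ : ℍ, oddTheta (2 * (r * (τ : ℂ) + s)) (2 * (τ : ℂ)) ≠ 0) :
    ∃ C A : ℝ, ∀ τ : ℍ, A ≤ τ.im →
      ‖autDenom γ τ ^ (-(1 / 2) : ℂ) * g2Torsion r s (γ • τ)‖ ≤ Real.exp (C * τ.im) := by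
  obtain ⟨C, A, hC⟩ := g2Sum_growth γ (r * γ 0 0 + s * γ 1 0) (r * γ 0 1 + s * γ 1 1)
  refine ⟨2 * Real.pi * (r * γ 0 0 + s * γ 1 0) ^ 2 + C, A, fun τ hτ => ?_⟩
  have hz := torsion_smul γ r s τ
  have ha := automorphy_exponent γ r s τ
  have hb := hC τ hτ
  push_cast at hb
  rw [← hz] at hb
  have hb' := hb (h _)
  have e : autDenom γ τ ^ (-(1 / 2) : ℂ) * g2Torsion r s (γ • τ) =
      Complex.exp (2 * Real.pi * Complex.I * -(((r * γ 0 0 + s * γ 1 0) ^ 2 : ℝ) * (τ : ℂ) +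
        ((r ^ 2 * γ 0 0 * γ 0 1 + 2 * r * s * γ 0 1 * γ 1 0 + s ^ 2 * γ 1 0 * γ 1 1 : ℝ) : ℂ))) *
      (autDenom γ τ ^ (-(1 / 2) : ℂ) *
        Complex.exp (2 * Real.pi * Complex.I * ((γ 1 0 : ℤ) : ℂ) *
          ((r * (γ 0 0 : ℤ) + s * (γ 1 0 : ℤ)) * τ + (r * (γ 0 1 : ℤ) + s * (γ 1 1 : ℤ))) ^ 2 /
            autDenom γ τ) * g2Sum (r * ((γ • τ : ℍ) : ℂ) + s, ((γ • τ : ℍ) : ℂ))) := by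
    have e1 : Complex.exp (-2 * Real.pi * Complex.I * r ^ 2 * ((γ • τ : ℍ) : ℂ)) =
        Complex.exp (2 * Real.pi * Complex.I * -(((r * γ 0 0 + s * γ 1 0) ^ 2 : ℝ) * (τ : ℂ) +
        ((r ^ 2 * γ 0 0 * γ 0 1 + 2 * r * s * γ 0 1 * γ 1 0 + s ^ 2 * γ 1 0 * γ 1 1 : ℝ) : ℂ))) *
        Complex.exp (2 * Real.pi * Complex.I * ((γ 1 0 : ℤ) : ℂ) *
          ((r * (γ 0 0 : ℤ) + s * (γ 1 0 : ℤ)) * τ + (r * (γ 0 1 : ℤ) + s * (γ 1 1 : ℤ))) ^ 2 /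
            autDenom γ τ) := by
      rw [← Complex.exp_add]
      congr 1
      push_cast
      linear_combination (-2 * Real.pi * Complex.I) * ha
    rw [g2Torsion, e1]
    ring
  rw [e, norm_mul, norm_exp_two_pi_mul_I_mul, add_mul _ C τ.im, Real.exp_add]
  refine mul_le_mul (Real.exp_le_exp.2 (le_of_eq ?_)) hb' (norm_nonneg _) (Real.exp_pos _).le
  rw [Complex.neg_im, Complex.add_im, Complex.im_ofReal_mul, Complex.ofReal_im,
    UpperHalfPlane.coe_im]
  ring

lemma exists_of_mem_Gamma {N : ℕ} {γ : SL(2, ℤ)} (h : γ ∈ CongruenceSubgroup.Gamma N) :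
    ∃ a b c d : ℤ, γ 0 0 = 1 + N * a ∧ γ 0 1 = N * b ∧ γ 1 0 = N * c ∧ γ 1 1 = 1 + N * d := by
  obtain ⟨h1, h2, h3, h4⟩ := CongruenceSubgroup.Gamma_mem.1 h
  have h1' : ((γ 0 0 - 1 : ℤ) : ZMod N) = 0 := by push_cast; rw [h1, sub_self]
  have h4' : ((γ 1 1 - 1 : ℤ) : ZMod N) = 0 := by push_cast; rw [h4, sub_self]
  obtain ⟨a, ha⟩ := (ZMod.intCast_zmod_eq_zero_iff_dvd _ _).1 h1'
  obtain ⟨b, hb⟩ := (ZMod.intCast_zmod_eq_zero_iff_dvd _ _).1 h2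
  obtain ⟨c, hc⟩ := (ZMod.intCast_zmod_eq_zero_iff_dvd _ _).1 h3
  obtain ⟨d, hd⟩ := (ZMod.intCast_zmod_eq_zero_iff_dvd _ _).1 h4'
  exact ⟨a, b, c, d, by linarith, hb, hc, by linarith⟩

theorem isWeaklyHolomorphicHalf_g2Torsion (r : ℚ) {M : ℕ} (hM : 0 < M) {s : ℚ} (hs : s.den ∣ M)
    (h : ¬ ((∃ n : ℤ, r = n) ∧ ∃ m : ℤ, 2 * s = m)) :
    IsWeaklyHolomorphicHalf (CongruenceSubgroup.Gamma (16 * r.den ^ 2 * M ^ 2))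
      (g2Torsion (r : ℂ) (s : ℂ)) where
  le_Gamma0 γ hγ := by
    obtain ⟨a, b, c, d, -, -, hc, -⟩ := exists_of_mem_Gamma hγ
    rw [CongruenceSubgroup.Gamma0_mem, ZMod.intCast_zmod_eq_zero_iff_dvd, hc]
    exact ⟨4 * r.den ^ 2 * M ^ 2 * c, by push_cast; ring⟩
  holomorphic := mdifferentiable_g2Torsion (oddTheta_torsion_ne_zero h)
  transform γ hγ τ := by
    obtain ⟨a, b, c, d, ha, hb, hc, hd⟩ := exists_of_mem_Gamma hγ
    push_cast at ha hb hc hd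
    obtain ⟨k, hk⟩ := hs
    have hD0 : (r.den : ℤ) ≠ 0 := by exact_mod_cast r.den_ne_zero
    have hM0 : (M : ℤ) ≠ 0 := by exact_mod_cast hM.ne'
    have hr : (r : ℂ) = ((r.num : ℤ) : ℂ) / ((r.den : ℤ) : ℂ) := by
      exact_mod_cast congrArg (fun x : ℚ => (x : ℂ)) r.num_div_den.symm
    -- Writing `s` over the common denominator `M` keeps the level independent of `s`.
    have hs' : (s : ℂ) = ((s.num * k : ℤ) : ℂ) / ((M : ℤ) : ℂ) := by
      have hk0 : (k : ℂ) ≠ 0 := by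
        rintro e
        rw [Nat.cast_eq_zero] at e
        rw [e, mul_zero] at hk
        exact hM.ne' hk
      rw [hk, Rat.cast_def]
      push_cast
      field_simp
    have hq := thetaQuot_smul (R := r.num) (S := s.num * k) hD0 hM0 ha hb hc hd τ
    rw [← hr, ← hs'] at hq
    rw [g2Torsion_eq (oddTheta_torsion_ne_zero h _), g2Torsion_eq (oddTheta_torsion_ne_zero h _), hq]
    ring
  cusps γ := by
    have := g2Torsion_growth (r := (r : ℝ)) (s := (s : ℝ)) γ (by
      simpa using oddTheta_torsion_ne_zero h)
    simpa using this

/-! ### The main theorem -/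

theorem theorem1p2 :
    (∀ (τ : ℍ) (α q w : ℂ), q = Complex.exp (2 * Real.pi * Complex.I * (τ : ℂ)) →
      w = Complex.exp (2 * Real.pi * Complex.I * α) →
      (∀ n m : ℤ, 2 * α ≠ 2 * n * (τ : ℂ) + m) →
        Summable (g2Term w q) ∧ Summable (g2Term (-w) q) ∧
        oddTheta (2 * α) (2 * (τ : ℂ)) ≠ 0 ∧
        w * (g2 w q + g2 (-w) q) =
          2 * ModularForm.eta (2 * (τ : ℂ)) ^ 4 /
            (ModularForm.eta (τ : ℂ) ^ 2 * oddTheta (2 * α) (2 * (τ : ℂ)))) ∧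
    IsMeromorphicJacobiForm (CongruenceSubgroup.Gamma0 2) (1 / 2) (-1)
      (fun l _ => (-1 : ℂ) ^ l) g2Sum ∧
    ∀ (r : ℚ) (M : ℕ), 0 < M →
      ∃ Γ : Subgroup SL(2, ℤ), CongruenceSubgroup.IsCongruenceSubgroup Γ ∧
        ∀ s : ℚ, s.den ∣ M → ¬ ((∃ n : ℤ, r = n) ∧ ∃ m : ℤ, 2 * s = m) →
          IsWeaklyHolomorphicHalf Γ (fun τ : ℍ =>
            Complex.exp (-2 * Real.pi * Complex.I * (r : ℂ) ^ 2 * (τ : ℂ)) *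
              g2Sum ((r : ℂ) * (τ : ℂ) + (s : ℂ), (τ : ℂ))) := by
  refine ⟨fun τ α q w hq hw h => ?_, isMeromorphicJacobiForm_g2Sum, fun r M hM => ?_⟩
  · obtain ⟨h1, h2, h3, h4⟩ := g2_even_part τ.im_pos h
    subst hq hw
    exact ⟨h1, h2, h3, by rw [← div_div]; exact h4⟩
  · have : NeZero (16 * r.den ^ 2 * M ^ 2) :=
      ⟨by have := r.den_ne_zero; have := hM.ne'; positivity⟩
    exact ⟨_, CongruenceSubgroup.Gamma_is_cong_sub (16 * r.den ^ 2 * M ^ 2), fun s hs h =>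
      isWeaklyHolomorphicHalf_g2Torsion r hM hs h⟩
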